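/- Let $d\ge 1$, let $\|\cdot\|$ be the Euclidean norm on $\mathbb R^d$, and let $B(z,r)$ be the closed ball with centre $z$ and radius $r$. Let $\mathbf N$ be the space of locally finite subsets of $\mathbb R^d$ with the $\sigma$-field generated by the maps $\varphi\mapsto\varphi(B):=\operatorname{card}(\varphi\cap B)$, $B\subset\mathbb R^d$ Borel. A point process is a random element of $\mathbf N$; it is stationary if $\Psi+x$ and $\Psi$ have the same distribution for all $x\in\mathbb R^d$, and then its intensity is $\alpha:=\mathbb E\,\Psi([0,1]^d)$. A point process $\Psi'$ is number rigid if for every bounded Borel set $B\subset\mathbb R^d$ there is a measurable function $g:\mathbf N\to\mathbb N_0$ such that $\Psi'(B)=g(\Psi'\cap B^c)$ almost surely. Matching. Let $\varphi,\psi\subset\mathbb R^d$ be locally finite. A point $p\in\varphi$ prefers $x\in\psi$ to $y\in\psi$ if $\|x-p\|<\|y-p\|$, or $\|x-p\|=\|y-p\|$ and $x$ is lexicographically strictly smaller than $y$. A point $x\in\psi$ prefers $p\in\varphi$ to $q\in\varphi$ if $\|p-x\|<\|q-x\|$, or $\|p-x\|=\|q-x\|$ and $p$ is lexicographically strictly greater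 than $q$. Put $\varphi_0:=\varphi$, $\psi_0:=\psi$. Given $(\varphi_n,\psi_n)$, match every pair $(p,x)\in\varphi_n\times\psi_n$ such that $x$ is the point of $\psi_n$ that $p$ prefers to all others and $p$ is the point of $\varphi_n$ that $x$ prefers to all others; let $\varphi_{n+1},\psi_{n+1}$ be the sets of points of $\varphi_n,\psi_n$ that are not matched in this step. For $z\in\varphi\cup\psi$ let $\tau(\varphi,\psi,z)$ be the partner of $z$ if $z$ is matched in some step, and $\tau(\varphi,\psi,z):=\infty$ otherwise. Matching flower. A descending chain in $(\varphi,\psi)$ is a sequence $(z_1,\dots,z_n)$, $n\ge 2$, with $z_i\in\varphi$ for odd $i$, $z_i\in\psi$ for even $i$, and such that $z_i$ prefers $z_{i+1}$ to $z_{i-1}$ for $2\le i\le n-1$. For $q\in\varphi$ with $\tau(\varphi,\psi,q)\neq\infty$, the matching flower $F(\varphi,\psi,q)$ is the union of the sets $$B(z_1,\|z_1-z_2\|)\cup\bigcup_{i=2}^n B(z_i,\|z_i-z_{i-1}\|)$$ over all descending chains $(z_1,\dots,z_n)$ in $(\varphi,\psi)$ with $z_1=q$ such that $z_2$ equals $\tau(\varphi,\psi,q)$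 or is preferred by $q$ to $\tau(\varphi,\psi,q)$. If $\tau(\varphi,\psi,q)=\infty$, then $F(\varphi,\psi,q):=\mathbb R^d$. Theorem. Let $\Psi$ be a stationary point process on $\mathbb R^d$ with intensity $\alpha\ge 1$, put $F(0):=F(\mathbb Z^d,\Psi,0)$, and assume that $$\sum_{w\in\mathbb Z^d}\mathbb P\bigl(F(0)\not\subset B(0,\|w\|)\bigr)<\infty .$$ Then the set of matched points $\Psi^\tau_0:=\{x\in\Psi:\tau(\mathbb Z^d,\Psi,x)\neq\infty\}$ is a number rigid point process. -/

import Mathlib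

open MeasureTheory ProbabilityTheory
open scoped ENNReal

/-- The Euclidean space `ℝ^d`. -/
abbrev E (d : ℕ) : Type := EuclideanSpace ℝ (Fin d)

/-- `x` is lexicographically strictly smaller than `y`. -/
def LexLT {d : ℕ} (x y : E d) : Prop :=
  toLex (fun i => x i) < toLex (fun i => y i)

/-- The integer vector `w`, viewed as a point of `ℝ^d`. -/
noncomputable def intPoint {d : ℕ} (w : Fin d → ℤ) : E d :=
  WithLp.toLp 2 (fun i => (w i : ℝ))

/-- The lattice `ℤ^d` as a subset of `ℝ^d`. -/
def intLattice (d : ℕ) : Set (E d) := Set.range (intPoint (d := d))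

/-! ## Locally finite sets and point processes -/

/-- The space `𝐍` of all locally finite subsets of `ℝ^d`. -/
def PointConfig (d : ℕ) : Type :=
  {s : Set (E d) // ∀ B : Set (E d), Bornology.IsBounded B → (s ∩ B).Finite}

namespace PointConfig

/-- The set of points of a configuration. -/
def points {d : ℕ} (φ : PointConfig d) : Set (E d) := φ.1

/-- `φ(B)`, the number of points of `φ` in `B`. -/
noncomputable def count {d : ℕ} (φ : PointConfig d) (B : Set (E d)) : ℕ∞ :=
  (φ.points ∩ B).encard

/-- The σ-field on `𝐍` generated by the mappings `φ ↦ φ(B)`, `B` a Borel set. -/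
noncomputable instance instMeasurableSpace (d : ℕ) : MeasurableSpace (PointConfig d) :=
  ⨆ (B : Set (E d)) (_ : MeasurableSet B), MeasurableSpace.comap (fun φ => φ.count B) ⊤

/-- A subset of a locally finite set is locally finite. -/
def ofSubset {d : ℕ} (φ : PointConfig d) (s : Set (E d)) (h : s ⊆ φ.points) : PointConfig d :=
  ⟨s, fun B hB => (φ.2 B hB).subset (Set.inter_subset_inter_left B h)⟩

/-- The restriction `φ ∩ B`. -/
def restrict {d : ℕ} (φ : PointConfig d) (B : Set (E d)) : PointConfig d :=
  φ.ofSubset (φ.points ∩ B) Set.inter_subset_left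

/-- The translate `φ + x`. -/
def translate {d : ℕ} (φ : PointConfig d) (x : E d) : PointConfig d :=
  ⟨(fun y => y + x) '' φ.points, fun B hB => by
    have hB' : Bornology.IsBounded ((fun y => y + (-x)) '' B) := by
      obtain ⟨r, hr⟩ := hB.exists_norm_le
      refine isBounded_iff_forall_norm_le.2 ⟨r + ‖x‖, ?_⟩
      rintro _ ⟨y, hy, rfl⟩
      have h1 := norm_add_le y (-x)
      rw [norm_neg] at h1
      linarith [hr y hy]
    refine ((φ.2 _ hB').image (fun y => y + x)).subset ?_
    rintro _ ⟨⟨y, hy, rfl⟩, hyB⟩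
    exact ⟨y, ⟨hy, y + x, hyB, by simp⟩, rfl⟩⟩

end PointConfig

/-- A point process `Ψ` (a random element of `𝐍`) is stationary: `Ψ + x` and `Ψ` have the same
distribution for every `x ∈ ℝ^d`. -/
def IsStationaryProcess {Ω : Type*} [MeasurableSpace Ω] {d : ℕ} (P : Measure Ω)
    (Ψ : Ω → PointConfig d) : Prop :=
  ∀ x : E d, IdentDistrib (fun ω => (Ψ ω).translate x) Ψ P P

/-- The intensity `𝔼[Ψ([0,1]^d)]`. -/
noncomputable def intensity {Ω : Type*} [MeasurableSpace Ω] {d : ℕ} (P : Measure Ω)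
    (Ψ : Ω → PointConfig d) : ℝ≥0∞ :=
  ∫⁻ ω, ((Ψ ω).count {x : E d | ∀ i, x i ∈ Set.Icc (0 : ℝ) 1} : ℝ≥0∞) ∂P

/-- Number rigidity: for every bounded Borel set `B` the number `Ψ(B)` is almost surely
a measurable function of `Ψ ∩ Bᶜ`. -/
def IsNumberRigid {Ω : Type*} [MeasurableSpace Ω] {d : ℕ} (P : Measure Ω)
    (Ψ : Ω → PointConfig d) : Prop :=
  ∀ B : Set (E d), MeasurableSet B → Bornology.IsBounded B →
    ∃ g : PointConfig d → ℕ, Measurable g ∧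
      ∀ᵐ ω ∂P, (Ψ ω).count B = (g ((Ψ ω).restrict Bᶜ) : ℕ∞)

/-! ## The mutual nearest neighbour matching -/

/-- `y` is a nearest neighbour of `x` in `A`. -/
def IsNearest {d : ℕ} (A : Set (E d)) (x y : E d) : Prop :=
  y ∈ A ∧ ∀ q ∈ A, ‖x - y‖ ≤ ‖x - q‖

/-- `y = N⁻(A, x)`: `y` is the lexicographically smallest nearest neighbour of `x` in `A`. -/
def IsNearestMin {d : ℕ} (A : Set (E d)) (x y : E d) : Prop :=
  IsNearest A x y ∧ ∀ q, IsNearest A x q → q ≠ y → LexLT y q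

/-- `y = N⁺(A, x)`: `y` is the lexicographically largest nearest neighbour of `x` in `A`. -/
def IsNearestMax {d : ℕ} (A : Set (E d)) (x y : E d) : Prop :=
  IsNearest A x y ∧ ∀ q, IsNearest A x q → q ≠ y → LexLT q y

/-- `p ∈ φ` and `x ∈ ψ` are mutual nearest neighbours: `N⁻(ψ, p) = x` and `N⁺(φ, x) = p`. -/
def MutualNearest {d : ℕ} (φ ψ : Set (E d)) (p x : E d) : Prop :=
  IsNearestMin ψ p x ∧ IsNearestMax φ x p

/-- The pair `(φ_n, ψ_n)` of points still unmatched after `n` rounds; in each round all pairs of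
mutual nearest neighbours are matched and removed. -/
def remaining {d : ℕ} (φ ψ : Set (E d)) : ℕ → Set (E d) × Set (E d)
  | 0 => (φ, ψ)
  | n + 1 =>
    ({p ∈ (remaining φ ψ n).1 |
        ¬ ∃ x, MutualNearest (remaining φ ψ n).1 (remaining φ ψ n).2 p x},
      {x ∈ (remaining φ ψ n).2 |
        ¬ ∃ p, MutualNearest (remaining φ ψ n).1 (remaining φ ψ n).2 p x})

/-- `p ∈ φ` and `x ∈ ψ` are matched to each other in some round. -/
def IsMatchedPair {d : ℕ} (φ ψ : Set (E d)) (p x : E d) : Prop :=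
  ∃ n, MutualNearest (remaining φ ψ n).1 (remaining φ ψ n).2 p x

open Classical in
/-- The mutual nearest neighbour matching `τ(φ, ψ, ·) : ℝ^d → ℝ^d ∪ {∞}`. A matched point is sent
to its (unique) partner, an unmatched point of `φ ∪ ψ` to `∞`, and other points to themselves. -/
noncomputable def matching {d : ℕ} (φ ψ : Set (E d)) (x : E d) : OnePoint (E d) :=
  if h : ∃ y, IsMatchedPair φ ψ x y ∨ IsMatchedPair φ ψ y x then ((h.choose : E d) : OnePoint (E d))
  else if x ∈ φ ∪ ψ then OnePoint.infty else (x : OnePoint (E d))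

/-- `ψ^τ = {x ∈ ψ : τ(φ, ψ, x) ≠ ∞}`, the configuration of matched points of `ψ`. -/
noncomputable def matchedPoints {d : ℕ} (φ : Set (E d)) (ψ : PointConfig d) : PointConfig d :=
  ψ.ofSubset {x ∈ ψ.points | matching φ ψ.points x ≠ OnePoint.infty} (Set.sep_subset _ _)

/-! ## The matching flower -/

/-- The point `p ∈ φ` prefers `x` to `y` (both in `ψ`): `x` is closer to `p`, ties being broken in
favour of the lexicographically smaller point. -/
def PhiPrefers {d : ℕ} (p x y : E d) : Prop :=
  ‖x - p‖ < ‖y - p‖ ∨ (‖x - p‖ = ‖y - p‖ ∧ LexLT x y)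

/-- The point `x ∈ ψ` prefers `p` to `q` (both in `φ`): `p` is closer to `x`, ties being broken in
favour of the lexicographically greater point. -/
def PsiPrefers {d : ℕ} (x p q : E d) : Prop :=
  ‖p - x‖ < ‖q - x‖ ∨ (‖p - x‖ = ‖q - x‖ ∧ LexLT q p)

/-- `(z 1, …, z n)` is a descending chain in `(φ, ψ)`: `n ≥ 2`, points with odd index lie in `φ`,
points with even index lie in `ψ`, and each interior point prefers its successor to its
predecessor. Values of `z` outside `{1, …, n}` are irrelevant. -/
structure IsDescendingChain {d : ℕ} (φ ψ : Set (E d)) (n : ℕ) (z : ℕ → E d) : Prop where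
  two_le : 2 ≤ n
  mem_of_odd : ∀ i, 1 ≤ i → i ≤ n → Odd i → z i ∈ φ
  mem_of_even : ∀ i, 1 ≤ i → i ≤ n → Even i → z i ∈ ψ
  prefers_of_odd : ∀ i, 2 ≤ i → i < n → Odd i → PhiPrefers (z i) (z (i + 1)) (z (i - 1))
  prefers_of_even : ∀ i, 2 ≤ i → i < n → Even i → PsiPrefers (z i) (z (i + 1)) (z (i - 1))

/-- `(z 1, …, z n)` is a competing chain for `q ∈ φ`, where `τ(φ, ψ, q) ≠ ∞`: a descending chain
with `z 1 = q` whose second point equals or is preferred (by `q`) to the partner of `q`. -/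
def IsCompetingChain {d : ℕ} (φ ψ : Set (E d)) (q : E d) (n : ℕ) (z : ℕ → E d) : Prop :=
  IsDescendingChain φ ψ n z ∧ z 1 = q ∧
    ∃ y : E d, matching φ ψ q = (y : OnePoint (E d)) ∧ (z 2 = y ∨ PhiPrefers q (z 2) y)

/-- The union `F_c` of balls attached to the chain `c = (z 1, …, z n)`. -/
def chainBalls {d : ℕ} (n : ℕ) (z : ℕ → E d) : Set (E d) :=
  Metric.closedBall (z 1) ‖z 1 - z 2‖ ∪
    ⋃ i ∈ Set.Icc 2 n, Metric.closedBall (z i) ‖z i - z (i - 1)‖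

open Classical in
/-- The matching flower `F(φ, ψ, q)` of a point `q ∈ φ` (only such `q` are considered): all of
`ℝ^d` if `q` is unmatched, otherwise the union of the sets `F_c` over all competing chains `c`
for `q`. -/
noncomputable def matchingFlower {d : ℕ} (φ ψ : Set (E d)) (q : E d) : Set (E d) :=
  if matching φ ψ q = OnePoint.infty then Set.univ
  else ⋃ (n : ℕ) (z : ℕ → E d) (_ : IsCompetingChain φ ψ q n z), chainBalls n z

/-! ## Preference orders -/

section Orders

variable {d : ℕ} {p x y z : E d}

-- Delete from the matched points `ψ^τ` those lying in a bounded set `B`, and match the remaining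
-- configuration `χ` with the lattice again. If every lattice point had a partner and only finitely
-- many partners are affected by the deletion, conservation of mass gives that the number of deleted
-- points equals the number of lattice points left unmatched minus the number of points of `χ` left
-- unmatched. This difference is a function of `χ` alone, which is number rigidity; the count is
-- `encard_matched_inter_add`.
--
-- The partner of `p` can change only if some partner in `B` is reachable from `p` along
-- `DependsStep`, by `IsMatchedPair.of_subset`. Matching flowers decrease along such steps
-- (`DependsStep.matchingFlower_subset`), so all partners reachable from `p` lie in the flower of
-- `p`. A distant lattice point affected by `B` therefore has a large flower.
--
-- Stationarity makes the probability of far dependence the same at all lattice points, and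
-- Borel–Cantelli with the summability assumption leaves finitely many affected points. Summability
-- also forces every lattice point to be matched, since an unmatched point has the whole space as
-- flower. The probabilistic argument runs through `HasFarDependence`, an event shown to be
-- measurable, so that equality in distribution applies to it.

theorem lexLT_iff : LexLT x y ↔ ∃ i, (∀ j, j < i → x j = y j) ∧ x i < y i := Iff.rfl

theorem LexLT.irrefl (x : E d) : ¬ LexLT x x := lt_irrefl _

theorem LexLT.trans (h : LexLT x y) (h' : LexLT y z) : LexLT x z := lt_trans h h'

theorem lexLT_or_lexLT (h : x ≠ y) : LexLT x y ∨ LexLT y x := by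
  refine lt_or_gt_of_ne (fun h' => h ?_)
  ext i
  exact congrFun (toLex.injective h') i

theorem lexLT_add_right (v : E d) : LexLT (x + v) (y + v) ↔ LexLT x y := by
  simp [lexLT_iff]

theorem PhiPrefers.irrefl (p x : E d) : ¬ PhiPrefers p x x := by
  rintro (h | ⟨-, h⟩)
  · exact lt_irrefl _ h
  · exact LexLT.irrefl _ h

theorem PhiPrefers.trans (h : PhiPrefers p x y) (h' : PhiPrefers p y z) : PhiPrefers p x z := by
  rcases h with h | ⟨h, hl⟩ <;> rcases h' with h' | ⟨h', hl'⟩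
  · exact .inl (h.trans h')
  · exact .inl (h' ▸ h)
  · exact .inl (h ▸ h')
  · exact .inr ⟨h.trans h', hl.trans hl'⟩

theorem PhiPrefers.asymm (h : PhiPrefers p x y) : ¬ PhiPrefers p y x :=
  fun h' => PhiPrefers.irrefl _ _ (h.trans h')

theorem PhiPrefers.ne (h : PhiPrefers p x y) : x ≠ y := by
  rintro rfl
  exact PhiPrefers.irrefl _ _ h

theorem phiPrefers_or (p : E d) (h : x ≠ y) : PhiPrefers p x y ∨ PhiPrefers p y x := by
  rcases lt_trichotomy ‖x - p‖ ‖y - p‖ with h1 | h1 | h1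
  · exact .inl (.inl h1)
  · rcases lexLT_or_lexLT h with h2 | h2
    · exact .inl (.inr ⟨h1, h2⟩)
    · exact .inr (.inr ⟨h1.symm, h2⟩)
  · exact .inr (.inl h1)

theorem PhiPrefers.norm_le (h : PhiPrefers p x y) : ‖x - p‖ ≤ ‖y - p‖ := by
  rcases h with h | h
  exacts [h.le, h.1.le]

theorem phiPrefers_add_right (v : E d) :
    PhiPrefers (p + v) (x + v) (y + v) ↔ PhiPrefers p x y := by
  simp [PhiPrefers, lexLT_add_right]

theorem PsiPrefers.irrefl (p x : E d) : ¬ PsiPrefers p x x := by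
  rintro (h | ⟨-, h⟩)
  · exact lt_irrefl _ h
  · exact LexLT.irrefl _ h

theorem PsiPrefers.trans (h : PsiPrefers p x y) (h' : PsiPrefers p y z) : PsiPrefers p x z := by
  rcases h with h | ⟨h, hl⟩ <;> rcases h' with h' | ⟨h', hl'⟩
  · exact .inl (h.trans h')
  · exact .inl (h' ▸ h)
  · exact .inl (h ▸ h')
  · exact .inr ⟨h.trans h', hl'.trans hl⟩

theorem PsiPrefers.asymm (h : PsiPrefers p x y) : ¬ PsiPrefers p y x :=
  fun h' => PsiPrefers.irrefl _ _ (h.trans h')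

theorem PsiPrefers.ne (h : PsiPrefers p x y) : x ≠ y := by
  rintro rfl
  exact PsiPrefers.irrefl _ _ h

theorem psiPrefers_or (p : E d) (h : x ≠ y) : PsiPrefers p x y ∨ PsiPrefers p y x := by
  rcases lt_trichotomy ‖x - p‖ ‖y - p‖ with h1 | h1 | h1
  · exact .inl (.inl h1)
  · rcases lexLT_or_lexLT h with h2 | h2
    · exact .inr (.inr ⟨h1.symm, h2⟩)
    · exact .inl (.inr ⟨h1, h2⟩)
  · exact .inr (.inl h1)

theorem PsiPrefers.norm_le (h : PsiPrefers p x y) : ‖x - p‖ ≤ ‖y - p‖ := by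
  rcases h with h | h
  exacts [h.le, h.1.le]

theorem psiPrefers_add_right (v : E d) :
    PsiPrefers (p + v) (x + v) (y + v) ↔ PsiPrefers p x y := by
  simp [PsiPrefers, lexLT_add_right]

theorem isNearestMin_iff {A : Set (E d)} :
    IsNearestMin A p x ↔ x ∈ A ∧ ∀ y ∈ A, y ≠ x → PhiPrefers p x y := by
  simp only [IsNearestMin, IsNearest, PhiPrefers, norm_sub_rev p]
  constructor
  · rintro ⟨⟨hx, hmin⟩, hlex⟩
    refine ⟨hx, fun y hy hne => ?_⟩
    rcases (hmin y hy).lt_or_eq with h | h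
    · exact .inl h
    · exact .inr ⟨h, hlex y ⟨hy, fun q hq => h ▸ hmin q hq⟩ hne⟩
  · rintro ⟨hx, h⟩
    have hmin : ∀ q ∈ A, ‖x - p‖ ≤ ‖q - p‖ := fun q hq => by
      by_cases hqx : q = x
      · rw [hqx]
      · exact PhiPrefers.norm_le (h q hq hqx)
    refine ⟨⟨hx, hmin⟩, fun q hq hne => ?_⟩
    rcases h q hq.1 hne with h1 | h1
    · exact absurd (hq.2 x hx) h1.not_ge
    · exact h1.2

theorem isNearestMax_iff {A : Set (E d)} :
    IsNearestMax A p x ↔ x ∈ A ∧ ∀ y ∈ A, y ≠ x → PsiPrefers p x y := by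
  simp only [IsNearestMax, IsNearest, PsiPrefers, norm_sub_rev p]
  constructor
  · rintro ⟨⟨hx, hmin⟩, hlex⟩
    refine ⟨hx, fun y hy hne => ?_⟩
    rcases (hmin y hy).lt_or_eq with h | h
    · exact .inl h
    · exact .inr ⟨h, hlex y ⟨hy, fun q hq => h ▸ hmin q hq⟩ hne⟩
  · rintro ⟨hx, h⟩
    have hmin : ∀ q ∈ A, ‖x - p‖ ≤ ‖q - p‖ := fun q hq => by
      by_cases hqx : q = x
      · rw [hqx]
      · exact PsiPrefers.norm_le (h q hq hqx)
    refine ⟨⟨hx, hmin⟩, fun q hq hne => ?_⟩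
    rcases h q hq.1 hne with h1 | h1
    · exact absurd (hq.2 x hx) h1.not_ge
    · exact h1.2

/-- Nearest neighbours with tie-breaking are the best points of strict total preference orders; the
later arguments use only these orders. -/
theorem mutualNearest_iff {φ ψ : Set (E d)} :
    MutualNearest φ ψ p x ↔ (x ∈ ψ ∧ ∀ y ∈ ψ, y ≠ x → PhiPrefers p x y) ∧
      (p ∈ φ ∧ ∀ q ∈ φ, q ≠ p → PsiPrefers x p q) := by
  rw [MutualNearest, isNearestMin_iff, isNearestMax_iff]

end Orders

/-! ## Deterministic properties of the matching -/

section Matching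

variable {d : ℕ} {φ ψ χ : Set (E d)} {p q x y : E d} {m n : ℕ}

/-- `p` and `x` are matched to each other in round `n`. -/
def MatchedAt (φ ψ : Set (E d)) (n : ℕ) (p x : E d) : Prop :=
  MutualNearest (remaining φ ψ n).1 (remaining φ ψ n).2 p x

theorem MatchedAt.isMatchedPair (h : MatchedAt φ ψ n p x) : IsMatchedPair φ ψ p x := ⟨n, h⟩

theorem remaining_succ_subset (φ ψ : Set (E d)) (n : ℕ) :
    (remaining φ ψ (n + 1)).1 ⊆ (remaining φ ψ n).1 ∧
      (remaining φ ψ (n + 1)).2 ⊆ (remaining φ ψ n).2 :=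
  ⟨Set.sep_subset _ _, Set.sep_subset _ _⟩

theorem remaining_fst_anti (φ ψ : Set (E d)) : Antitone fun n => (remaining φ ψ n).1 :=
  antitone_nat_of_succ_le fun n => (remaining_succ_subset φ ψ n).1

theorem remaining_snd_anti (φ ψ : Set (E d)) : Antitone fun n => (remaining φ ψ n).2 :=
  antitone_nat_of_succ_le fun n => (remaining_succ_subset φ ψ n).2

theorem MatchedAt.mem_fst (h : MatchedAt φ ψ n p x) : p ∈ (remaining φ ψ n).1 :=
  (mutualNearest_iff.1 h).2.1

theorem MatchedAt.mem_snd (h : MatchedAt φ ψ n p x) : x ∈ (remaining φ ψ n).2 :=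
  (mutualNearest_iff.1 h).1.1

theorem IsMatchedPair.mem_left (h : IsMatchedPair φ ψ p x) : p ∈ φ := by
  obtain ⟨n, h⟩ := h
  exact remaining_fst_anti φ ψ (Nat.zero_le n) (MatchedAt.mem_fst h)

theorem IsMatchedPair.mem_right (h : IsMatchedPair φ ψ p x) : x ∈ ψ := by
  obtain ⟨n, h⟩ := h
  exact remaining_snd_anti φ ψ (Nat.zero_le n) (MatchedAt.mem_snd h)

theorem exists_matchedAt_of_notMem_fst (hp : p ∈ φ) (h : p ∉ (remaining φ ψ n).1) :
    ∃ m < n, ∃ x, MatchedAt φ ψ m p x := by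
  induction n with
  | zero => exact absurd hp h
  | succ n ih =>
    by_cases hn : p ∈ (remaining φ ψ n).1
    · by_contra! hc
      exact h ⟨hn, fun ⟨x, hx⟩ => hc n n.lt_succ_self x hx⟩
    · obtain ⟨m, hm, hx⟩ := ih hn
      exact ⟨m, hm.trans n.lt_succ_self, hx⟩

theorem exists_matchedAt_of_notMem_snd (hx : x ∈ ψ) (h : x ∉ (remaining φ ψ n).2) :
    ∃ m < n, ∃ p, MatchedAt φ ψ m p x := by
  induction n with
  | zero => exact absurd hx h
  | succ n ih =>
    by_cases hn : x ∈ (remaining φ ψ n).2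
    · by_contra! hc
      exact h ⟨hn, fun ⟨p, hp⟩ => hc n n.lt_succ_self p hp⟩
    · obtain ⟨m, hm, hp⟩ := ih hn
      exact ⟨m, hm.trans n.lt_succ_self, hp⟩

theorem MatchedAt.notMem_fst (h : MatchedAt φ ψ m p x) (hmn : m < n) :
    p ∉ (remaining φ ψ n).1 :=
  fun hp => (remaining_fst_anti φ ψ (Nat.succ_le_of_lt hmn) hp).2 ⟨x, h⟩

theorem MatchedAt.notMem_snd (h : MatchedAt φ ψ m p x) (hmn : m < n) :
    x ∉ (remaining φ ψ n).2 :=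
  fun hx => (remaining_snd_anti φ ψ (Nat.succ_le_of_lt hmn) hx).2 ⟨p, h⟩

theorem IsMatchedPair.right_unique (h : IsMatchedPair φ ψ p x) (h' : IsMatchedPair φ ψ p y) :
    x = y := by
  obtain ⟨n, h⟩ := h
  obtain ⟨m, h'⟩ := h'
  rcases lt_trichotomy n m with hnm | rfl | hnm
  · exact absurd (MatchedAt.mem_fst h') (MatchedAt.notMem_fst h hnm)
  · by_contra hne
    rw [mutualNearest_iff] at h h'
    exact (h.1.2 y h'.1.1 (Ne.symm hne)).asymm (h'.1.2 x h.1.1 hne)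
  · exact absurd (MatchedAt.mem_fst h) (MatchedAt.notMem_fst h' hnm)

theorem IsMatchedPair.left_unique (h : IsMatchedPair φ ψ p x) (h' : IsMatchedPair φ ψ q x) :
    p = q := by
  obtain ⟨n, h⟩ := h
  obtain ⟨m, h'⟩ := h'
  rcases lt_trichotomy n m with hnm | rfl | hnm
  · exact absurd (MatchedAt.mem_snd h') (MatchedAt.notMem_snd h hnm)
  · by_contra hne
    rw [mutualNearest_iff] at h h'
    exact (h.2.2 q h'.2.1 (Ne.symm hne)).asymm (h'.2.2 p h.2.1 hne)
  · exact absurd (MatchedAt.mem_snd h) (MatchedAt.notMem_snd h' hnm)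

/-- A point which `p` prefers to its partner is matched earlier, to a point it prefers to `p`. -/
theorem MatchedAt.exists_of_phiPrefers (h : MatchedAt φ ψ n p x) (hy : y ∈ ψ)
    (hyx : PhiPrefers p y x) : ∃ m < n, ∃ q, MatchedAt φ ψ m q y ∧ PsiPrefers y q p := by
  have hn : y ∉ (remaining φ ψ n).2 := fun hyn =>
    ((mutualNearest_iff.1 h).1.2 y hyn hyx.ne).asymm hyx
  obtain ⟨m, hm, q, hq⟩ := exists_matchedAt_of_notMem_snd hy hn
  refine ⟨m, hm, q, hq, (mutualNearest_iff.1 hq).2.2 p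
    (remaining_fst_anti φ ψ hm.le h.mem_fst) ?_⟩
  rintro rfl
  exact hq.notMem_fst hm h.mem_fst

/-- A point which `x` prefers to its partner is matched earlier, to a point it prefers to `x`. -/
theorem MatchedAt.exists_of_psiPrefers (h : MatchedAt φ ψ n p x) (hq : q ∈ φ)
    (hqp : PsiPrefers x q p) : ∃ m < n, ∃ y, MatchedAt φ ψ m q y ∧ PhiPrefers q y x := by
  have hn : q ∉ (remaining φ ψ n).1 := fun hqn =>
    ((mutualNearest_iff.1 h).2.2 q hqn hqp.ne).asymm hqp
  obtain ⟨m, hm, y, hy⟩ := exists_matchedAt_of_notMem_fst hq hn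
  refine ⟨m, hm, y, hy, (mutualNearest_iff.1 hy).1.2 x
    (remaining_snd_anti φ ψ hm.le h.mem_snd) ?_⟩
  rintro rfl
  exact hy.notMem_snd hm h.mem_snd

/-- Local finiteness enters here: finitely many competitors are all gone after one common round. -/
theorem exists_round_of_finite {ι : Type*} {S : Set ι} (hS : S.Finite) {Q : ℕ → ι → Prop}
    (h : ∀ s ∈ S, ∃ n, Q n s) : ∃ N, ∀ s ∈ S, ∃ n < N, Q n s := by
  choose! f hf using h
  obtain ⟨N, hN⟩ := (hS.image f).bddAbove
  exact ⟨N + 1, fun s hs => ⟨f s, Nat.lt_succ_of_le (hN ⟨s, hs, rfl⟩), hf s hs⟩⟩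

/-- If all competitors of `p ∈ φ` and `x ∈ ψ` are matched, then `p` or `x` is matched. -/
theorem exists_isMatchedPair_or (hp : p ∈ φ) (hx : x ∈ ψ)
    (hfinψ : {y ∈ ψ | PhiPrefers p y x}.Finite) (hfinφ : {q ∈ φ | PsiPrefers x q p}.Finite)
    (hψ : ∀ y ∈ ψ, PhiPrefers p y x → ∃ q, IsMatchedPair φ ψ q y)
    (hφ : ∀ q ∈ φ, PsiPrefers x q p → ∃ y, IsMatchedPair φ ψ q y) :
    (∃ y, IsMatchedPair φ ψ p y) ∨ ∃ q, IsMatchedPair φ ψ q x := by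
  by_contra! hc
  obtain ⟨hcp, hcx⟩ := hc
  obtain ⟨N, hN⟩ := exists_round_of_finite hfinψ (Q := fun n y => ∃ q, MatchedAt φ ψ n q y)
    fun y hy => by
      obtain ⟨q, n, h⟩ := hψ y hy.1 hy.2
      exact ⟨n, q, h⟩
  obtain ⟨K, hK⟩ := exists_round_of_finite hfinφ (Q := fun n q => ∃ y, MatchedAt φ ψ n q y)
    fun q hq => by
      obtain ⟨y, n, h⟩ := hφ q hq.1 hq.2
      exact ⟨n, y, h⟩
  -- By round `max N K` every competitor has been removed. If `p` and `x` are both still unmatched,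
  -- they are then mutual nearest neighbours.
  refine hcp x ⟨max N K, mutualNearest_iff.2 ⟨⟨?_, fun y hy hne => ?_⟩, ?_, fun q hq hne => ?_⟩⟩
  · by_contra h
    obtain ⟨m, -, q, hq⟩ := exists_matchedAt_of_notMem_snd hx h
    exact hcx q ⟨m, hq⟩
  · refine (phiPrefers_or p hne).resolve_left fun h => ?_
    obtain ⟨n, hn, q, hq⟩ := hN y ⟨remaining_snd_anti φ ψ (Nat.zero_le _) hy, h⟩
    exact hq.notMem_snd (lt_max_of_lt_left hn) hy
  · by_contra h
    obtain ⟨m, -, y, hy⟩ := exists_matchedAt_of_notMem_fst hp h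
    exact hcp y ⟨m, hy⟩
  · refine (psiPrefers_or x hne).resolve_left fun h => ?_
    obtain ⟨n, hn, y, hy⟩ := hK q ⟨remaining_fst_anti φ ψ (Nat.zero_le _) hq, h⟩
    exact hy.notMem_fst (lt_max_of_lt_right hn) hq

/-- A sufficient condition for `p` and `x` to be matched: the points that `p` prefers to `x`, and
those that `x` prefers to `p`, are all matched elsewhere. -/
theorem isMatchedPair_of_forall (hp : p ∈ φ) (hx : x ∈ ψ)
    (hfinψ : {y ∈ ψ | PhiPrefers p y x}.Finite) (hfinφ : {q ∈ φ | PsiPrefers x q p}.Finite)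
    (hψ : ∀ y ∈ ψ, PhiPrefers p y x → ∃ q, q ≠ p ∧ IsMatchedPair φ ψ q y)
    (hφ : ∀ q ∈ φ, PsiPrefers x q p → ∃ y, y ≠ x ∧ IsMatchedPair φ ψ q y) :
    IsMatchedPair φ ψ p x := by
  rcases exists_isMatchedPair_or hp hx hfinψ hfinφ
    (fun y hy h => (hψ y hy h).imp fun _ h => h.2)
    (fun q hq h => (hφ q hq h).imp fun _ h => h.2) with ⟨y, hy⟩ | ⟨q, hq⟩
  · by_cases hyx : y = x
    · exact hyx ▸ hy
    exfalso
    -- Either `p` prefers `y`, which is matched elsewhere by `hψ`, or `p` prefers `x` to its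
    -- partner. In the latter case `x` was taken by some `q` it prefers to `p`, against `hφ`.
    rcases phiPrefers_or p hyx with h | h
    · obtain ⟨q, hne, hq⟩ := hψ y hy.mem_right h
      exact hne (hq.left_unique hy)
    · obtain ⟨n, hn⟩ := hy
      obtain ⟨m, -, q, hq, hqp⟩ := MatchedAt.exists_of_phiPrefers hn hx h
      obtain ⟨z, hzx, hz⟩ := hφ q hq.isMatchedPair.mem_left hqp
      exact hzx (hz.right_unique hq.isMatchedPair)
  · by_cases hqp : q = p
    · exact hqp ▸ hq
    exfalso
    rcases psiPrefers_or x hqp with h | h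
    · obtain ⟨y, hne, hy⟩ := hφ q hq.mem_left h
      exact hne (hy.right_unique hq)
    · obtain ⟨n, hn⟩ := hq
      obtain ⟨m, -, y, hy, hyx⟩ := MatchedAt.exists_of_psiPrefers hn hp h
      obtain ⟨r, hrp, hr⟩ := hψ y hy.isMatchedPair.mem_right hyx
      exact hrp (hr.left_unique hy.isMatchedPair)

/-- One step of the dependence of the partner of `p` on the partners of other points. -/
def DependsStep (φ ψ : Set (E d)) (p q : E d) : Prop :=
  ∃ x ∈ ψ, ∃ y ∈ ψ, IsMatchedPair φ ψ p x ∧ IsMatchedPair φ ψ q y ∧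
    ((PhiPrefers p y x ∧ PsiPrefers y q p) ∨ (PsiPrefers x q p ∧ PhiPrefers q y x))

/-- The partner of `p` is unchanged if the configuration `ψ` is replaced by a subset
that contains the partners of all points on which the partner of `p` depends. -/
theorem IsMatchedPair.of_subset (hφ : ∀ B, Bornology.IsBounded B → (φ ∩ B).Finite)
    (hψ : ∀ B, Bornology.IsBounded B → (ψ ∩ B).Finite) (hχψ : χ ⊆ ψ)
    (h : IsMatchedPair φ ψ p x)
    (hχ : ∀ q y, Relation.ReflTransGen (DependsStep φ ψ) p q → IsMatchedPair φ ψ q y → y ∈ χ) :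
    IsMatchedPair φ χ p x := by
  obtain ⟨n, hn⟩ := h
  induction n using Nat.strong_induction_on generalizing p x with
  | _ n ih =>
  have hn' : MatchedAt φ ψ n p x := hn
  have hM := hn'.isMatchedPair
  -- The criterion does not mention rounds, which may differ between `ψ` and `χ`. Competitors are
  -- matched in strictly earlier rounds of `ψ`, so the induction hypothesis gives them the same
  -- partners in `χ`.
  refine isMatchedPair_of_forall hM.mem_left (hχ p x .refl hM) ?_ ?_ ?_ ?_
  · refine (hψ _ (Metric.isBounded_closedBall (x := p) (r := ‖x - p‖))).subset ?_
    exact fun y hy => ⟨hχψ hy.1, mem_closedBall_iff_norm.2 hy.2.norm_le⟩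
  · refine (hφ _ (Metric.isBounded_closedBall (x := x) (r := ‖p - x‖))).subset ?_
    exact fun q hq => ⟨hq.1, mem_closedBall_iff_norm.2 hq.2.norm_le⟩
  · intro y hy hyx
    obtain ⟨m, hm, q, hq, hqp⟩ := hn'.exists_of_phiPrefers (hχψ hy) hyx
    refine ⟨q, hqp.ne, ih m hm (fun r z hr => hχ r z (.head ?_ hr)) hq⟩
    exact ⟨x, hM.mem_right, y, hχψ hy, hM, hq.isMatchedPair, .inl ⟨hyx, hqp⟩⟩
  · intro q hqφ hqp
    obtain ⟨m, hm, y, hy, hyx⟩ := hn'.exists_of_psiPrefers hqφ hqp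
    refine ⟨y, hyx.ne, ih m hm (fun r z hr => hχ r z (.head ?_ hr)) hy⟩
    exact ⟨x, hM.mem_right, y, hy.isMatchedPair.mem_right, hM, hy.isMatchedPair,
      .inr ⟨hqp, hyx⟩⟩

/-- A common point of `φ` and `ψ` is matched to itself. -/
theorem isMatchedPair_self (hp : p ∈ φ) (hp' : p ∈ ψ) : IsMatchedPair φ ψ p p := by
  refine ⟨0, mutualNearest_iff.2 ⟨⟨hp', fun y _ hy => .inl ?_⟩, hp, fun y _ hy => .inl ?_⟩⟩ <;>
  simpa [sub_eq_zero] using hy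

/-- The arbitrary choice inside `matching` is harmless: if `p` also lies in `ψ`, it is its own
partner on both sides. -/
theorem IsMatchedPair.matching_left (h : IsMatchedPair φ ψ p x) :
    matching φ ψ p = (x : OnePoint (E d)) := by
  have hex : ∃ y, IsMatchedPair φ ψ p y ∨ IsMatchedPair φ ψ y p := ⟨x, .inl h⟩
  rw [matching, dif_pos hex]
  congr 1
  rcases hex.choose_spec with h1 | h1
  · exact h1.right_unique h
  · have hp := isMatchedPair_self h.mem_left h1.mem_right
    rw [h1.left_unique hp, h.right_unique hp]

theorem matching_left_ne_infty_iff (hp : p ∈ φ) :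
    matching φ ψ p ≠ OnePoint.infty ↔ ∃ x, IsMatchedPair φ ψ p x := by
  constructor
  · intro h
    by_contra hc
    refine h ?_
    rw [matching, dif_neg, if_pos (.inl hp)]
    rintro ⟨y, hy | hy⟩
    · exact hc ⟨y, hy⟩
    · exact hc ⟨p, isMatchedPair_self hp hy.mem_right⟩
  · rintro ⟨x, hx⟩
    rw [hx.matching_left]
    exact OnePoint.coe_ne_infty _

theorem matching_right_ne_infty_iff (hx : x ∈ ψ) :
    matching φ ψ x ≠ OnePoint.infty ↔ ∃ p, IsMatchedPair φ ψ p x := by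
  constructor
  · intro h
    by_contra hc
    refine h ?_
    rw [matching, dif_neg, if_pos (.inr hx)]
    rintro ⟨y, hy | hy⟩
    · exact hc ⟨x, isMatchedPair_self hy.mem_left hx⟩
    · exact hc ⟨y, hy⟩
  · rintro ⟨p, hp⟩
    have hex : ∃ y, IsMatchedPair φ ψ x y ∨ IsMatchedPair φ ψ y x := ⟨p, .inr hp⟩
    rw [matching, dif_pos hex]
    exact OnePoint.coe_ne_infty _

theorem mem_matchedPoints_iff {ψ : PointConfig d} :
    x ∈ (matchedPoints φ ψ).points ↔ ∃ p, IsMatchedPair φ ψ.points p x := by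
  change (x ∈ ψ.points ∧ matching φ ψ.points x ≠ OnePoint.infty) ↔ _
  constructor
  · rintro ⟨hx, h⟩
    exact (matching_right_ne_infty_iff hx).1 h
  · rintro ⟨p, hp⟩
    exact ⟨hp.mem_right, (matching_right_ne_infty_iff hp.mem_right).2 ⟨p, hp⟩⟩

/-! ### Translations -/

theorem mutualNearest_image_add (v : E d) :
    MutualNearest ((· + v) '' φ) ((· + v) '' ψ) (p + v) (x + v) ↔ MutualNearest φ ψ p x := by
  simp only [mutualNearest_iff, Set.forall_mem_image, (add_left_injective v).mem_set_image,
    phiPrefers_add_right, psiPrefers_add_right, ne_eq, add_left_inj]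

theorem remaining_image_add (v : E d) (n : ℕ) :
    remaining ((· + v) '' φ) ((· + v) '' ψ) n =
      ((· + v) '' (remaining φ ψ n).1, (· + v) '' (remaining φ ψ n).2) := by
  induction n with
  | zero => rfl
  | succ n ih =>
    have hsurj : Function.Surjective (fun y : E d => y + v) := fun y => ⟨y - v, by simp⟩
    rw [remaining, ih]
    refine Prod.ext (Set.ext fun z => ?_) (Set.ext fun z => ?_)
    · obtain ⟨z, rfl⟩ := hsurj z
      rw [(add_left_injective v).mem_set_image]
      change (_ ∧ ¬ _) ↔ (_ ∧ ¬ _)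
      rw [(add_left_injective v).mem_set_image, hsurj.exists]
      simp only [mutualNearest_image_add]
    · obtain ⟨z, rfl⟩ := hsurj z
      rw [(add_left_injective v).mem_set_image]
      change (_ ∧ ¬ _) ↔ (_ ∧ ¬ _)
      rw [(add_left_injective v).mem_set_image, hsurj.exists]
      simp only [mutualNearest_image_add]

theorem isMatchedPair_image_add (v : E d) :
    IsMatchedPair ((· + v) '' φ) ((· + v) '' ψ) (p + v) (x + v) ↔ IsMatchedPair φ ψ p x := by
  simp only [IsMatchedPair, remaining_image_add, mutualNearest_image_add]

theorem dependsStep_image_add (v : E d) :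
    DependsStep ((· + v) '' φ) ((· + v) '' ψ) (p + v) (q + v) ↔ DependsStep φ ψ p q := by
  simp only [DependsStep, Set.exists_mem_image, isMatchedPair_image_add, phiPrefers_add_right,
    psiPrefers_add_right]

end Matching

/-! ## Measurable enumerations of random sets -/

section Measurability

variable {T T' : Type*} [MeasurableSpace T] [MeasurableSpace T'] {d : ℕ}

/-- A random set is measurably enumerable if it is the union of countably many measurable points,
each of which is present on a measurable event. -/
def MeasurablyEnumerable (A : T → Set (E d)) : Prop :=
  ∃ (a : ℕ → T → E d) (s : ℕ → Set T), (∀ k, Measurable (a k)) ∧ (∀ k, MeasurableSet (s k)) ∧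
    ∀ t x, x ∈ A t ↔ ∃ k, t ∈ s k ∧ a k t = x

namespace MeasurablyEnumerable

variable {A B : T → Set (E d)}

theorem comp (hA : MeasurablyEnumerable A) {f : T' → T} (hf : Measurable f) :
    MeasurablyEnumerable fun t => A (f t) := by
  obtain ⟨a, s, ha, hs, h⟩ := hA
  exact ⟨fun k t => a k (f t), fun k => f ⁻¹' s k, fun k => (ha k).comp hf,
    fun k => hf (hs k), fun t x => h (f t) x⟩

theorem sep (hA : MeasurablyEnumerable A) {p : T → E d → Prop}
    (hp : MeasurableSet {u : T × E d | p u.1 u.2}) :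
    MeasurablyEnumerable fun t => {x ∈ A t | p t x} := by
  obtain ⟨a, s, ha, hs, h⟩ := hA
  refine ⟨a, fun k => s k ∩ {t | p t (a k t)}, ha,
    fun k => (hs k).inter ((measurable_id.prodMk (ha k)) hp), fun t x => ?_⟩
  change (x ∈ A t ∧ p t x) ↔ ∃ k, (t ∈ s k ∧ p t (a k t)) ∧ a k t = x
  rw [h]
  constructor
  · rintro ⟨⟨k, hk, rfl⟩, hx⟩
    exact ⟨k, ⟨hk, hx⟩, rfl⟩
  · rintro ⟨k, ⟨hk, hx⟩, rfl⟩
    exact ⟨⟨k, hk, rfl⟩, hx⟩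

theorem measurableSet_exists (hA : MeasurablyEnumerable A) {p : T → E d → Prop}
    (hp : MeasurableSet {u : T × E d | p u.1 u.2}) :
    MeasurableSet {t | ∃ x ∈ A t, p t x} := by
  obtain ⟨a, s, ha, hs, h⟩ := hA
  have : {t | ∃ x ∈ A t, p t x} = ⋃ k, s k ∩ {t | p t (a k t)} := by
    ext t
    simp only [Set.mem_iUnion, h]
    constructor
    · rintro ⟨_, ⟨k, hk, rfl⟩, hx⟩
      exact ⟨k, hk, hx⟩
    · rintro ⟨k, hk, hx⟩
      exact ⟨_, ⟨k, hk, rfl⟩, hx⟩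
  rw [this]
  exact .iUnion fun k => (hs k).inter ((measurable_id.prodMk (ha k)) hp)

theorem measurableSet_forall (hA : MeasurablyEnumerable A) {p : T → E d → Prop}
    (hp : MeasurableSet {u : T × E d | p u.1 u.2}) :
    MeasurableSet {t | ∀ x ∈ A t, p t x} := by
  have := (hA.measurableSet_exists (p := fun t x => ¬ p t x) hp.compl).compl
  convert this using 1
  ext t
  change (∀ x ∈ A t, p t x) ↔ ¬ ∃ x ∈ A t, ¬ p t x
  push Not
  rfl

theorem measurableSet_mem (hA : MeasurablyEnumerable A) {f : T → E d} (hf : Measurable f) :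
    MeasurableSet {t | f t ∈ A t} := by
  have := hA.measurableSet_exists (p := fun t x => x = f t)
    (measurableSet_eq_fun measurable_snd (hf.comp measurable_fst))
  simpa using this

/-- Having at least `n` points means that some `n` indices are present with pairwise distinct
points, a countable union over index tuples. -/
theorem measurable_encard (hA : MeasurablyEnumerable A) :
    Measurable fun t => (A t).encard := by
  obtain ⟨a, s, ha, hs, h⟩ := hA
  have key : ∀ n : ℕ, MeasurableSet {t | (n : ℕ∞) ≤ (A t).encard} := by
    intro n
    have : {t | (n : ℕ∞) ≤ (A t).encard} =
        ⋃ F : Fin n → ℕ, (⋂ i, s (F i)) ∩ ⋂ (i) (j) (_ : i ≠ j), {t | a (F i) t = a (F j) t}ᶜ := by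
      ext t
      simp only [Set.mem_iUnion, Set.mem_inter_iff, Set.mem_iInter]
      constructor
      · intro ht
        obtain ⟨u, hu, hun⟩ := Set.exists_subset_encard_eq ht
        have hfin : u.Finite := Set.finite_of_encard_eq_coe hun
        have hcard : Nat.card u = n := by
          rw [Nat.card_coe_set_eq, Set.ncard, hun]; rfl
        have := hfin.to_subtype
        let e := (Finite.equivFinOfCardEq hcard).symm
        choose F hF hFa using fun i => (h t (e i)).1 (hu (e i).2)
        refine ⟨F, hF, fun i j hij (heq : a (F i) t = a (F j) t) => hij ?_⟩
        rw [hFa, hFa] at heq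
        exact e.injective (Subtype.ext heq)
      · rintro ⟨F, hF, hne⟩
        have hinj : Function.Injective fun i => a (F i) t := fun i j hij => by
          by_contra hc
          exact hne i j hc hij
        have hsub : Set.range (fun i => a (F i) t) ⊆ A t := by
          rintro _ ⟨i, rfl⟩
          exact (h t _).2 ⟨F i, hF i, rfl⟩
        refine le_trans ?_ (Set.encard_le_encard hsub)
        rw [← Set.image_univ, hinj.encard_image, Set.encard_univ]
        simp
    rw [this]
    exact .iUnion fun F => (MeasurableSet.iInter fun i => hs _).inter
      (.iInter fun i => .iInter fun j => .iInter fun _ =>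
        (measurableSet_eq_fun (ha _) (ha _)).compl)
  refine measurable_to_countable' fun c => ?_
  induction c using ENat.recTopCoe with
  | top =>
    have : (fun t => (A t).encard) ⁻¹' {⊤} = ⋂ n : ℕ, {t | (n : ℕ∞) ≤ (A t).encard} := by
      ext t
      simp only [Set.mem_preimage, Set.mem_singleton_iff, Set.mem_iInter]
      exact ENat.eq_top_iff_forall_ge
    rw [this]
    exact .iInter key
  | coe n =>
    have : (fun t => (A t).encard) ⁻¹' {(n : ℕ∞)} =
        {t | (n : ℕ∞) ≤ (A t).encard} \ {t | ((n + 1 : ℕ) : ℕ∞) ≤ (A t).encard} := by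
      ext t
      change (A t).encard = n ↔ (n : ℕ∞) ≤ (A t).encard ∧ ¬ ((n + 1 : ℕ) : ℕ∞) ≤ (A t).encard
      rw [Nat.cast_add, Nat.cast_one, ENat.add_one_le_iff (ENat.natCast_ne_top n), not_lt,
        and_comm, le_antisymm_iff]
    rw [this]
    exact (key n).diff (key (n + 1))

theorem of_countable {S : Set (E d)} (hS : S.Countable) :
    MeasurablyEnumerable fun _ : T => S := by
  rcases S.eq_empty_or_nonempty with rfl | hne
  · exact ⟨fun _ _ => 0, fun _ => ∅, fun _ => measurable_const, fun _ => .empty, by simp⟩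
  · obtain ⟨f, rfl⟩ := hS.exists_eq_range hne
    exact ⟨fun k _ => f k, fun _ => Set.univ, fun _ => measurable_const, fun _ => .univ,
      by simp⟩

end MeasurablyEnumerable

-- Enumerating the points of a configuration by counts

namespace PointConfig

theorem measurable_count {B : Set (E d)} (hB : MeasurableSet B) :
    Measurable fun φ : PointConfig d => φ.count B := by
  have : MeasurableSpace.comap (fun φ : PointConfig d => φ.count B) ⊤ ≤
      instMeasurableSpace d :=
    le_iSup₂_of_le (f := fun (B : Set (E d)) (_ : MeasurableSet B) =>
      MeasurableSpace.comap (fun φ : PointConfig d => φ.count B) ⊤) B hB le_rfl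
  exact Measurable.mono (comap_measurable _) this le_top

theorem measurable_of_count {f : T → PointConfig d}
    (hf : ∀ B, MeasurableSet B → Measurable fun t => (f t).count B) : Measurable f := by
  refine measurable_iff_comap_le.2 ?_
  simp only [instMeasurableSpace, MeasurableSpace.comap_iSup, iSup_le_iff,
    MeasurableSpace.comap_comp]
  intro B hB
  exact (hf B hB).comap_le

theorem measurable_of_enumerable {f : T → PointConfig d}
    (hf : MeasurablyEnumerable fun t => (f t).points) : Measurable f := by
  refine measurable_of_count fun B hB => ?_
  exact (hf.sep (p := fun _ x => x ∈ B) (measurable_snd hB)).measurable_encard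

open Classical in
/-- The point of `φ` in `Q` if there is exactly one. -/
noncomputable def pointIn (Q : Set (E d)) (φ : PointConfig d) : E d :=
  if h : ∃ x, φ.points ∩ Q = {x} then h.choose else 0

theorem pointIn_eq {Q : Set (E d)} {φ : PointConfig d} {x : E d} (h : φ.points ∩ Q = {x}) :
    pointIn Q φ = x := by
  have hex : ∃ x, φ.points ∩ Q = {x} := ⟨x, h⟩
  rw [pointIn, dif_pos hex]
  exact Set.singleton_injective (hex.choose_spec.symm.trans h)

/-- When `Q` holds exactly one point, that point lies in `B` exactly when `Q ∩ B` has count one;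
otherwise the value is the default `0`. -/
theorem measurable_pointIn {Q : Set (E d)} (hQ : MeasurableSet Q) :
    Measurable (pointIn Q : PointConfig d → E d) := by
  have h1 : MeasurableSet {φ : PointConfig d | φ.count Q = 1} :=
    measurable_count hQ (measurableSet_singleton 1)
  intro B hB
  have : (pointIn Q : PointConfig d → E d) ⁻¹' B =
      ({φ | φ.count Q = 1} ∩ {φ | φ.count (Q ∩ B) = 1}) ∪
        ({φ | φ.count Q = 1}ᶜ ∩ {_φ | (0 : E d) ∈ B}) := by
    ext φ
    by_cases h : φ.count Q = 1
    · obtain ⟨x, hx⟩ := Set.encard_eq_one.1 h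
      have : φ.count (Q ∩ B) = ({x} ∩ B : Set (E d)).encard := by
        rw [count, ← Set.inter_assoc, hx]
      by_cases hxB : x ∈ B <;>
      simp [h, this, pointIn_eq hx, hxB]
    · have h0 : pointIn Q φ = 0 := by
        rw [pointIn, dif_neg]
        rwa [count, Set.encard_eq_one] at h
      simp [h, h0]
  rw [this]
  exact (h1.inter (measurable_count (hQ.inter hB) (measurableSet_singleton 1))).union
    (h1.compl.inter (.const _))

/-- Points of a locally finite set are isolated, so each is the only configuration point in some
member of a countable base. Indexing by that base gives the enumeration, with repetitions. -/
theorem enumerable_points : MeasurablyEnumerable fun φ : PointConfig d => φ.points := by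
  obtain ⟨U, hU, -⟩ := (TopologicalSpace.isBasis_countableBasis (E d)).exists_subset_of_mem_open
    (Set.mem_univ 0) isOpen_univ
  obtain ⟨Q, hQ⟩ :=
    (TopologicalSpace.countable_countableBasis (E d)).exists_eq_range ⟨U, hU⟩
  have hopen : ∀ k, IsOpen (Q k) := fun k =>
    TopologicalSpace.isOpen_of_mem_countableBasis (hQ ▸ Set.mem_range_self k)
  refine ⟨fun k => pointIn (Q k), fun k => {φ | φ.count (Q k) = 1},
    fun k => measurable_pointIn (hopen k).measurableSet,
    fun k => measurable_count (hopen k).measurableSet (measurableSet_singleton 1),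
    fun φ x => ⟨fun hx => ?_, ?_⟩⟩
  · have hfin : ((φ.points ∩ Metric.ball x 1) \ {x}).Finite :=
      (φ.2 _ Metric.isBounded_ball).subset Set.sdiff_subset
    obtain ⟨U, hU, hxU, hsub⟩ :=
      (TopologicalSpace.isBasis_countableBasis (E d)).exists_subset_of_mem_open
      -- A unit ball about `x` with the finitely many other points removed.
      (a := x) (u := Metric.ball x 1 ∩ ((φ.points ∩ Metric.ball x 1) \ {x})ᶜ)
      ⟨Metric.mem_ball_self one_pos, fun h => h.2 rfl⟩
      (Metric.isOpen_ball.inter hfin.isClosed.isOpen_compl)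
    rw [hQ] at hU
    obtain ⟨k, rfl⟩ := hU
    have hk : φ.points ∩ Q k = {x} := by
      refine Set.eq_singleton_iff_unique_mem.2 ⟨⟨hx, hxU⟩, fun y hy => ?_⟩
      by_contra hyx
      exact (hsub hy.2).2 ⟨⟨hy.1, (hsub hy.2).1⟩, hyx⟩
    exact ⟨k, Set.encard_eq_one.2 ⟨x, hk⟩, pointIn_eq hk⟩
  · rintro ⟨k, hk, rfl⟩
    obtain ⟨x, hx⟩ := Set.encard_eq_one.1 hk
    change pointIn (Q k) φ ∈ φ.points
    rw [pointIn_eq hx]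
    exact (hx ▸ Set.mem_singleton x : x ∈ φ.points ∩ Q k).1

end PointConfig

/-! ### Measurability of the matching -/

theorem measurableSet_lexLT : MeasurableSet {u : E d × E d | LexLT u.1 u.2} := by
  have : {u : E d × E d | LexLT u.1 u.2} =
      ⋃ i, (⋂ (j) (_ : j < i), {u | u.1 j = u.2 j}) ∩ {u | u.1 i < u.2 i} := by
    ext u
    simp [lexLT_iff]
  rw [this]
  refine .iUnion fun i => .inter (.iInter fun j => .iInter fun _ => ?_) ?_
  · exact measurableSet_eq_fun (by fun_prop) (by fun_prop)
  · exact measurableSet_lt (by fun_prop) (by fun_prop)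

theorem measurableSet_phiPrefers {f g h : T → E d} (hf : Measurable f) (hg : Measurable g)
    (hh : Measurable h) : MeasurableSet {t | PhiPrefers (f t) (g t) (h t)} := by
  refine MeasurableSet.union (s₁ := {t | ‖g t - f t‖ < ‖h t - f t‖}) (measurableSet_lt ?_ ?_)
    (MeasurableSet.inter (s₁ := {t | ‖g t - f t‖ = ‖h t - f t‖}) (measurableSet_eq_fun ?_ ?_)
    ((hg.prodMk hh) measurableSet_lexLT)) <;> fun_prop

theorem measurableSet_psiPrefers {f g h : T → E d} (hf : Measurable f) (hg : Measurable g)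
    (hh : Measurable h) : MeasurableSet {t | PsiPrefers (f t) (g t) (h t)} := by
  refine MeasurableSet.union (s₁ := {t | ‖g t - f t‖ < ‖h t - f t‖}) (measurableSet_lt ?_ ?_)
    (MeasurableSet.inter (s₁ := {t | ‖g t - f t‖ = ‖h t - f t‖}) (measurableSet_eq_fun ?_ ?_)
    ((hh.prodMk hg) measurableSet_lexLT)) <;> fun_prop

theorem measurableSet_mutualNearest {A B : T → Set (E d)} (hA : MeasurablyEnumerable A)
    (hB : MeasurablyEnumerable B) {f g : T → E d} (hf : Measurable f) (hg : Measurable g) :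
    MeasurableSet {t | MutualNearest (A t) (B t) (f t) (g t)} := by
  simp only [mutualNearest_iff]
  refine .inter (.inter (hB.measurableSet_mem hg) (hB.measurableSet_forall ?_))
    (.inter (hA.measurableSet_mem hf) (hA.measurableSet_forall ?_))
  · exact .imp (measurableSet_eq_fun measurable_snd (hg.comp measurable_fst)).compl
      (measurableSet_phiPrefers (hf.comp measurable_fst) (hg.comp measurable_fst) measurable_snd)
  · exact .imp (measurableSet_eq_fun measurable_snd (hf.comp measurable_fst)).compl
      (measurableSet_psiPrefers (hg.comp measurable_fst) (hf.comp measurable_fst) measurable_snd)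

variable {A B : T → Set (E d)}

theorem MeasurablyEnumerable.remaining (hA : MeasurablyEnumerable A)
    (hB : MeasurablyEnumerable B) (n : ℕ) :
    MeasurablyEnumerable (fun t => (_root_.remaining (A t) (B t) n).1) ∧
      MeasurablyEnumerable (fun t => (_root_.remaining (A t) (B t) n).2) := by
  induction n with
  | zero => exact ⟨hA, hB⟩
  | succ n ih =>
    have key {f g : (T × E d) × E d → E d} (hf : Measurable f) (hg : Measurable g) :=
      measurableSet_mutualNearest (ih.1.comp (measurable_fst.comp measurable_fst))
        (ih.2.comp (measurable_fst.comp measurable_fst)) hf hg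
    constructor
    · refine ih.1.sep (MeasurableSet.compl ?_)
      have := (ih.2.comp measurable_fst).measurableSet_exists
        (p := fun (u : T × E d) x => MutualNearest (_root_.remaining (A u.1) (B u.1) n).1
          (_root_.remaining (A u.1) (B u.1) n).2 u.2 x)
        (key (measurable_snd.comp measurable_fst) measurable_snd)
      -- A mutual nearest neighbour lies in the remaining set, so the unrestricted quantifier equals
      -- the one over the enumerable set.
      exact this.congr (Set.ext fun u =>
        ⟨fun ⟨x, _, hx⟩ => ⟨x, hx⟩, fun ⟨x, hx⟩ => ⟨x, (mutualNearest_iff.1 hx).1.1, hx⟩⟩)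
    · refine ih.2.sep (MeasurableSet.compl ?_)
      have := (ih.1.comp measurable_fst).measurableSet_exists
        (p := fun (u : T × E d) p => MutualNearest (_root_.remaining (A u.1) (B u.1) n).1
          (_root_.remaining (A u.1) (B u.1) n).2 p u.2)
        (key measurable_snd (measurable_snd.comp measurable_fst))
      exact this.congr (Set.ext fun u =>
        ⟨fun ⟨x, _, hx⟩ => ⟨x, hx⟩, fun ⟨x, hx⟩ => ⟨x, (mutualNearest_iff.1 hx).2.1, hx⟩⟩)

theorem measurableSet_isMatchedPair (hA : MeasurablyEnumerable A)
    (hB : MeasurablyEnumerable B) {f g : T → E d} (hf : Measurable f) (hg : Measurable g) :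
    MeasurableSet {t | IsMatchedPair (A t) (B t) (f t) (g t)} := by
  have : {t | IsMatchedPair (A t) (B t) (f t) (g t)} =
      ⋃ n, {t | MutualNearest (remaining (A t) (B t) n).1 (remaining (A t) (B t) n).2 (f t) (g t)} := by
    ext t
    simp [IsMatchedPair]
  rw [this]
  exact .iUnion fun n => measurableSet_mutualNearest (hA.remaining hB n).1 (hA.remaining hB n).2 hf hg

theorem measurableSet_exists_isMatchedPair_left (hA : MeasurablyEnumerable A)
    (hB : MeasurablyEnumerable B) {f : T → E d} (hf : Measurable f) :
    MeasurableSet {t | ∃ x, IsMatchedPair (A t) (B t) (f t) x} := by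
  have := hB.measurableSet_exists (p := fun t x => IsMatchedPair (A t) (B t) (f t) x)
    (measurableSet_isMatchedPair (hA.comp measurable_fst) (hB.comp measurable_fst)
      (hf.comp measurable_fst) measurable_snd)
  convert this using 1
  ext t
  exact ⟨fun ⟨x, hx⟩ => ⟨x, hx.mem_right, hx⟩, fun ⟨x, _, hx⟩ => ⟨x, hx⟩⟩

theorem measurableSet_exists_isMatchedPair_right (hA : MeasurablyEnumerable A)
    (hB : MeasurablyEnumerable B) {f : T → E d} (hf : Measurable f) :
    MeasurableSet {t | ∃ p, IsMatchedPair (A t) (B t) p (f t)} := by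
  have := hA.measurableSet_exists (p := fun t p => IsMatchedPair (A t) (B t) p (f t))
    (measurableSet_isMatchedPair (hA.comp measurable_fst) (hB.comp measurable_fst)
      measurable_snd (hf.comp measurable_fst))
  convert this using 1
  ext t
  exact ⟨fun ⟨x, hx⟩ => ⟨x, hx.mem_left, hx⟩, fun ⟨x, _, hx⟩ => ⟨x, hx⟩⟩

theorem measurableSet_dependsStep (hA : MeasurablyEnumerable A)
    (hB : MeasurablyEnumerable B) {f g : T → E d} (hf : Measurable f) (hg : Measurable g) :
    MeasurableSet {t | DependsStep (A t) (B t) (f t) (g t)} := by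
  refine hB.measurableSet_exists ((hB.comp measurable_fst).measurableSet_exists ?_)
  have hA' : MeasurablyEnumerable fun u : (T × E d) × E d => A u.1.1 :=
    hA.comp (measurable_fst.comp measurable_fst)
  have hB' : MeasurablyEnumerable fun u : (T × E d) × E d => B u.1.1 :=
    hB.comp (measurable_fst.comp measurable_fst)
  have hx : Measurable fun u : (T × E d) × E d => u.1.2 := measurable_snd.comp measurable_fst
  have hf' : Measurable fun u : (T × E d) × E d => f u.1.1 :=
    hf.comp (measurable_fst.comp measurable_fst)
  have hg' : Measurable fun u : (T × E d) × E d => g u.1.1 :=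
    hg.comp (measurable_fst.comp measurable_fst)
  refine .inter (measurableSet_isMatchedPair hA' hB' hf' hx)
    (.inter (measurableSet_isMatchedPair hA' hB' hg' measurable_snd) (.union ?_ ?_))
  · exact .inter (measurableSet_phiPrefers hf' measurable_snd hx)
      (measurableSet_psiPrefers measurable_snd hg' hf')
  · exact .inter (measurableSet_psiPrefers hx hg' hf')
      (measurableSet_phiPrefers hg' measurable_snd hx)

theorem measurable_matchedPoints {φ : Set (E d)} (hφ : φ.Countable) :
    Measurable fun ψ : PointConfig d => matchedPoints φ ψ := by
  refine PointConfig.measurable_of_enumerable ?_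
  have := PointConfig.enumerable_points.sep
    (p := fun (ψ : PointConfig d) x => ∃ p, IsMatchedPair φ ψ.points p x)
    (measurableSet_exists_isMatchedPair_right (.of_countable hφ)
      (PointConfig.enumerable_points.comp measurable_fst) measurable_snd)
  convert this using 1
  ext ψ x
  rw [mem_matchedPoints_iff]
  exact ⟨fun ⟨p, hp⟩ => ⟨hp.mem_right, p, hp⟩, fun h => h.2⟩

end Measurability

/-! ## Matching flowers -/

section Flower

variable {d : ℕ} {φ ψ : Set (E d)} {p q x y u v : E d} {n : ℕ} {z : ℕ → E d} {r : ℝ}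

theorem IsMatchedPair.isCompetingChain_iff (h : IsMatchedPair φ ψ q y) :
    IsCompetingChain φ ψ q n z ↔
      IsDescendingChain φ ψ n z ∧ z 1 = q ∧ (z 2 = y ∨ PhiPrefers q (z 2) y) := by
  refine and_congr_right fun _ => and_congr_right fun _ => ?_
  rw [h.matching_left]
  constructor
  · rintro ⟨y', hy', h'⟩
    rwa [OnePoint.coe_injective hy']
  · exact fun h' => ⟨y, rfl, h'⟩

theorem IsMatchedPair.mem_matchingFlower_iff (h : IsMatchedPair φ ψ q y) :
    x ∈ matchingFlower φ ψ q ↔ ∃ n z, IsCompetingChain φ ψ q n z ∧ x ∈ chainBalls n z := by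
  rw [matchingFlower, if_neg ((matching_left_ne_infty_iff h.mem_left).2 ⟨y, h⟩)]
  simp

theorem mem_chainBalls_iff : x ∈ chainBalls n z ↔
    ‖x - z 1‖ ≤ ‖z 1 - z 2‖ ∨ ∃ i, 2 ≤ i ∧ i ≤ n ∧ ‖x - z i‖ ≤ ‖z i - z (i - 1)‖ := by
  simp [chainBalls, dist_eq_norm, and_assoc]

theorem IsMatchedPair.mem_matchingFlower (h : IsMatchedPair φ ψ q y) :
    y ∈ matchingFlower φ ψ q := by
  refine h.mem_matchingFlower_iff.2 ⟨2, fun i => if i = 1 then q else y,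
    h.isCompetingChain_iff.2 ⟨⟨le_rfl, ?_, ?_, by omega, by omega⟩, by simp, by simp⟩, ?_⟩
  · intro i h1 h2 ho
    obtain rfl : i = 1 := by
      rcases ho with ⟨k, rfl⟩
      omega
    simpa using h.mem_left
  · intro i h1 h2 he
    obtain rfl : i = 2 := by
      rcases he with ⟨k, rfl⟩
      omega
    simpa using h.mem_right
  · rw [mem_chainBalls_iff]
    exact .inr ⟨2, le_rfl, le_rfl, by simp⟩

/-- Two points put in front of a chain `z`. -/
def prependChain (p u : E d) (z : ℕ → E d) : ℕ → E d
  | 0 => p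
  | 1 => p
  | 2 => u
  | k + 3 => z (k + 1)

theorem IsDescendingChain.prepend (hz : IsDescendingChain φ ψ n z) (hp : p ∈ φ) (hu : u ∈ ψ)
    (h1 : PsiPrefers u (z 1) p) (h2 : PhiPrefers (z 1) (z 2) u) :
    IsDescendingChain φ ψ (n + 2) (prependChain p u z) := by
  have hn := hz.two_le
  refine ⟨by omega, fun i hi hin ho => ?_, fun i hi hin he => ?_, fun i hi hin ho => ?_,
    fun i hi hin he => ?_⟩
  · match i, hi with
    | 1, _ => exact hp
    | 2, _ => exact absurd ho (by decide)
    | k + 3, _ => exact hz.mem_of_odd (k + 1) (by omega) (by omega) (by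
        rw [Nat.odd_iff] at ho ⊢; omega)
  · match i, hi with
    | 1, _ => exact absurd he (by decide)
    | 2, _ => exact hu
    | k + 3, _ => exact hz.mem_of_even (k + 1) (by omega) (by omega) (by
        rw [Nat.even_iff] at he ⊢; omega)
  · match i, hi with
    | 2, _ => exact absurd ho (by decide)
    | 3, _ => exact h2
    | k + 4, _ => exact hz.prefers_of_odd (k + 2) (by omega) (by omega) (by
        rw [Nat.odd_iff] at ho ⊢; omega)
  · match i, hi with
    | 2, _ => exact h1
    | 3, _ => exact absurd he (by decide)
    | k + 4, _ => exact hz.prefers_of_even (k + 2) (by omega) (by omega) (by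
        rw [Nat.even_iff] at he ⊢; omega)

/-- All balls of `z` reappear with index shifted by two, except the one about `z 1`, whose radius
grows to `‖z 1 - u‖`. That ball has index 3 in the new chain; as no lower bound on `n` is assumed,
the three-point chain is listed separately. -/
theorem chainBalls_subset_prependChain (p : E d) (h : PhiPrefers (z 1) (z 2) u) :
    chainBalls n z ⊆ chainBalls (n + 2) (prependChain p u z) ∪ chainBalls 3 (prependChain p u z) := by
  intro x hx
  rw [mem_chainBalls_iff] at hx
  rcases hx with hx | ⟨i, hi, hin, hx⟩
  · refine .inr (mem_chainBalls_iff.2 (.inr ⟨3, by norm_num, le_rfl, ?_⟩))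
    change ‖x - z 1‖ ≤ ‖z 1 - u‖
    refine hx.trans ?_
    rw [norm_sub_rev, norm_sub_rev (z 1)]
    exact h.norm_le
  · refine .inl (mem_chainBalls_iff.2 (.inr ⟨i + 2, by omega, by omega, ?_⟩))
    obtain ⟨k, rfl⟩ := Nat.exists_eq_add_of_le' hi
    exact hx

/-- Every competing chain for `q` is turned into competing chains for `p` whose balls cover the
original ones, by prepending `p` and a point of `ψ` or, when that fails, by replacing `q` with `p`.
-/
theorem DependsStep.matchingFlower_subset (h : DependsStep φ ψ p q) :
    matchingFlower φ ψ q ⊆ matchingFlower φ ψ p := by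
  obtain ⟨x, hx, y, hy, hpx, hqy, h⟩ := h
  intro a ha
  obtain ⟨n, z, hcomp, hball⟩ := hqy.mem_matchingFlower_iff.1 ha
  obtain ⟨hz, hz1, hz2⟩ := hqy.isCompetingChain_iff.1 hcomp
  clear ha hcomp
  have hn := hz.two_le
  have key (u : E d) (hu : u ∈ ψ) (hux : u = x ∨ PhiPrefers p u x) (hqp : PsiPrefers u q p)
      (hzu : PhiPrefers q (z 2) u) : a ∈ matchingFlower φ ψ p := by
    subst hz1
    refine hpx.mem_matchingFlower_iff.2 ⟨n + 2, prependChain p u z,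
      hpx.isCompetingChain_iff.2 ⟨hz.prepend hpx.mem_left hu hqp hzu, rfl, hux⟩, ?_⟩
    refine (Set.union_subset subset_rfl ?_) (chainBalls_subset_prependChain p hzu hball)
    intro b hb
    rw [mem_chainBalls_iff] at hb ⊢
    exact hb.imp_right fun ⟨i, h1, h2, h3⟩ => ⟨i, h1, by omega, h3⟩
  rcases h with ⟨hyx, hqp⟩ | ⟨hqp, hyx⟩
  -- If the chain passes from `q` to its partner `y`, prepending `(p, y)` would require `q` to
  -- prefer `y` to itself. Replacing `q` by `p` works instead: `y` prefers its successor to `q` and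
  -- `q` to `p`.
  · rcases hz2 with hz2 | hz2
    swap
    · exact key y hy (.inr hyx) hqp hz2
    have hchain : IsDescendingChain φ ψ n (Function.update z 1 p) := by
      refine ⟨hn, fun i hi hin ho => ?_, fun i hi hin he => ?_, fun i hi hin ho => ?_,
        fun i hi hin he => ?_⟩
      · by_cases h1 : i = 1
        · simpa [h1] using hpx.mem_left
        · simpa [h1] using hz.mem_of_odd i hi hin ho
      · have h1 : i ≠ 1 := by rintro rfl; exact absurd he (by decide)
        simpa [h1] using hz.mem_of_even i hi hin he
      · have h1 : i ≠ 1 := by omega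
        have h2 : i - 1 ≠ 1 := fun h2 => by
          obtain rfl : i = 2 := by omega
          exact absurd ho (by decide)
        have h3 : i + 1 ≠ 1 := by omega
        rw [Function.update_of_ne h1, Function.update_of_ne h2, Function.update_of_ne h3]
        exact hz.prefers_of_odd i hi hin ho
      · have h1 : i ≠ 1 := by omega
        have h3 : i + 1 ≠ 1 := by omega
        have := hz.prefers_of_even i hi hin he
        rw [Function.update_of_ne h1, Function.update_of_ne h3]
        by_cases h2 : i = 2
        · subst h2
          simp only [Nat.add_one_sub_one, Function.update_self]
          rw [show 2 - 1 = 1 from rfl, hz1] at this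
          rw [hz2] at this ⊢
          exact this.trans hqp
        · rw [Function.update_of_ne (by omega)]
          exact this
    -- The replacement loses the ball about `q`; the chain `(p, y, q)` recovers it.
    have hshort : IsDescendingChain φ ψ 3 (prependChain p y fun _ => q) := by
      refine ⟨by norm_num, fun i hi hin ho => ?_, fun i hi hin he => ?_, fun i hi hin ho => ?_,
        fun i hi hin he => ?_⟩
      · match i, hi with
        | 1, _ => exact hpx.mem_left
        | 2, _ => exact absurd ho (by decide)
        | 3, _ => exact hqy.mem_left
      · match i, hi with
        | 1, _ => exact absurd he (by decide)
        | 2, _ => exact hy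
        | 3, _ => exact absurd he (by decide)
      · obtain rfl : i = 2 := by omega
        exact absurd ho (by decide)
      · obtain rfl : i = 2 := by omega
        exact hqp
    rw [hpx.mem_matchingFlower_iff]
    rcases mem_chainBalls_iff.1 hball with ha | ⟨i, hi, hin, ha⟩
    · refine ⟨3, _, hpx.isCompetingChain_iff.2 ⟨hshort, rfl, .inr hyx⟩,
        mem_chainBalls_iff.2 (.inr ⟨3, by norm_num, le_rfl, ?_⟩)⟩
      rw [hz1, hz2] at ha
      exact ha
    · refine ⟨n, _, hpx.isCompetingChain_iff.2 ⟨hchain, by simp, .inr (by simpa [hz2] using hyx)⟩,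
        mem_chainBalls_iff.2 (.inr ⟨i, hi, hin, ?_⟩)⟩
      rw [Function.update_of_ne (by omega)]
      by_cases h2 : i = 2
      · subst h2
        rw [show 2 - 1 = 1 from rfl, hz1, hz2] at ha
        rw [show 2 - 1 = 1 from rfl, Function.update_self, hz2]
        refine ha.trans ?_
        rw [norm_sub_rev, norm_sub_rev y]
        exact hqp.norm_le
      · rwa [Function.update_of_ne (by omega)]
  -- Here `q` prefers `y`, hence also `z 2`, to `x`, so `(p, x)` can be prepended in every case.
  · refine key x hx (.inl rfl) hqp ?_
    rcases hz2 with hz2 | hz2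
    · rwa [hz2]
    · exact hz2.trans hyx

/-- The point `p` is unmatched or its partner depends on a point of `ψ` at distance more than `r`
from `p`. -/
def HasFarDependence (φ ψ : Set (E d)) (r : ℝ) (p : E d) : Prop :=
  (¬ ∃ x, IsMatchedPair φ ψ p x) ∨ ∃ q ∈ φ, Relation.ReflTransGen (DependsStep φ ψ) p q ∧
    ∃ y ∈ ψ, IsMatchedPair φ ψ q y ∧ r < ‖y - p‖

/-- An unmatched `p` has the whole space as flower, which is unbounded since `d ≥ 1`. Otherwise
flowers nest along dependence, and the flower of `q` contains the partner of `q`. -/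
theorem HasFarDependence.not_matchingFlower_subset (hd : 1 ≤ d) (hp : p ∈ φ)
    (h : HasFarDependence φ ψ r p) : ¬ matchingFlower φ ψ p ⊆ Metric.closedBall p r := by
  intro hsub
  rcases h with h | ⟨q, -, hpq, y, -, hqy, hr⟩
  · rw [← matching_left_ne_infty_iff hp, not_not] at h
    rw [matchingFlower, if_pos h] at hsub
    have : Nontrivial (E d) := by
      have : Nonempty (Fin d) := ⟨⟨0, hd⟩⟩
      infer_instance
    exact NormedSpace.unbounded_univ ℝ (E d) (Metric.isBounded_closedBall.subset hsub)
  · have hflower : matchingFlower φ ψ q ⊆ matchingFlower φ ψ p := by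
      clear hqy
      induction hpq with
      | refl => rfl
      | tail _ h ih => exact h.matchingFlower_subset.trans ih
    exact hr.not_ge (mem_closedBall_iff_norm.1 (hsub (hflower hqy.mem_matchingFlower)))

theorem HasFarDependence.image_add (h : HasFarDependence φ ψ r p) (v : E d) :
    HasFarDependence ((· + v) '' φ) ((· + v) '' ψ) r (p + v) := by
  rcases h with h | ⟨q, hq, hpq, y, hy, hqy, hr⟩
  · refine .inl ?_
    rintro ⟨x, hx⟩
    obtain ⟨x, -, rfl⟩ := hx.mem_right
    exact h ⟨x, (isMatchedPair_image_add v).1 hx⟩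
  · refine .inr ⟨q + v, ⟨q, hq, rfl⟩, ?_, y + v, ⟨y, hy, rfl⟩, (isMatchedPair_image_add v).2 hqy,
      by simpa using hr⟩
    exact hpq.lift (· + v) fun _ _ => (dependsStep_image_add v).2

theorem measurableSet_hasFarDependence (hφ : φ.Countable) (r : ℝ) (p : E d) :
    MeasurableSet {ψ : PointConfig d | HasFarDependence φ ψ.points r p} := by
  have hφE {T : Type} [MeasurableSpace T] : MeasurablyEnumerable fun _ : T => φ :=
    .of_countable hφ
  have hreach : MeasurableSet {u : PointConfig d × E d |
      Relation.ReflTransGen (DependsStep φ u.1.points) p u.2} := by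
    -- Reachability in exactly `n` steps. Intermediate points of a path lie in the countable set
    -- `φ`, so each stage is a countable union.
    let S : ℕ → PointConfig d → E d → Prop := fun n ψ => n.rec (fun q => q = p)
      fun _ R q => ∃ q' ∈ φ, R q' ∧ DependsStep φ ψ.points q' q
    have hS : ∀ n, MeasurableSet {u : PointConfig d × E d | S n u.1 u.2} := by
      intro n
      induction n with
      | zero => exact measurableSet_eq_fun measurable_snd measurable_const
      | succ n ih =>
        refine hφE.measurableSet_exists
          (p := fun (u : PointConfig d × E d) q' => S n u.1 q' ∧ DependsStep φ u.1.points q' u.2)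
          (.inter ((measurable_fst.fst.prodMk measurable_snd) ih)
            (measurableSet_dependsStep hφE
              (PointConfig.enumerable_points.comp measurable_fst.fst) measurable_snd
              measurable_fst.snd))
    convert MeasurableSet.iUnion hS using 1
    ext ⟨η, q⟩
    rw [Set.mem_iUnion]
    change Relation.ReflTransGen (DependsStep φ η.points) p q ↔ ∃ n, S n η q
    constructor
    · intro h
      induction h with
      | refl => exact ⟨0, rfl⟩
      | tail _ h ih =>
        obtain ⟨n, hn⟩ := ih
        obtain ⟨x, hx, y, hy, hpx, -⟩ := id h
        exact ⟨n + 1, _, hpx.mem_left, hn, h⟩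
    · rintro ⟨n, hn⟩
      induction n generalizing q with
      | zero => exact (show q = p from hn) ▸ .refl
      | succ n ih =>
        obtain ⟨q', -, hq', h⟩ := hn
        exact (ih q' hq').tail h
  refine .union (measurableSet_exists_isMatchedPair_left hφE PointConfig.enumerable_points
    measurable_const).compl (hφE.measurableSet_exists (.inter hreach ?_))
  refine (PointConfig.enumerable_points.comp measurable_fst).measurableSet_exists (.inter
    (measurableSet_isMatchedPair hφE (PointConfig.enumerable_points.comp measurable_fst.fst)
      measurable_fst.snd measurable_snd) ?_)
  exact measurableSet_lt measurable_const (measurable_snd.sub_const p).norm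

end Flower

/-! ## Counting matched points -/

section Counting

variable {d : ℕ} {φ ψ : Set (E d)}

/-- If all points of `φ` are matched to points of `ψ`, and the partners of only finitely many of
them depend on points in `B`, then the number of matched points in `B` is the number of unmatched
points of `φ` minus the number of unmatched points of `χ`, where `χ` is the configuration of the
matched points outside `B`. -/
theorem encard_matched_inter_add (hφ : ∀ B, Bornology.IsBounded B → (φ ∩ B).Finite)
    (hψ : ∀ B, Bornology.IsBounded B → (ψ ∩ B).Finite) {B χ : Set (E d)}
    (hχ : ∀ x, x ∈ χ ↔ (∃ p, IsMatchedPair φ ψ p x) ∧ x ∉ B)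
    (hall : ∀ p ∈ φ, ∃ x, IsMatchedPair φ ψ p x)
    (hfin : {p ∈ φ | ∃ q y, Relation.ReflTransGen (DependsStep φ ψ) p q ∧
      IsMatchedPair φ ψ q y ∧ y ∈ B}.Finite) :
    {x | (∃ p, IsMatchedPair φ ψ p x) ∧ x ∈ B}.encard +
        {x ∈ χ | ¬ ∃ p, IsMatchedPair φ χ p x}.encard =
      {p ∈ φ | ¬ ∃ x, IsMatchedPair φ χ p x}.encard ∧
      {p ∈ φ | ¬ ∃ x, IsMatchedPair φ χ p x}.Finite := by
  set K := {p ∈ φ | ∃ q y, Relation.ReflTransGen (DependsStep φ ψ) p q ∧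
      IsMatchedPair φ ψ q y ∧ y ∈ B} with hK
  have hKφ : K ⊆ φ := Set.sep_subset _ _
  choose! f hf using hall
  have hχψ : χ ⊆ ψ := fun x hx => by
    obtain ⟨⟨p, hp⟩, -⟩ := (hχ x).1 hx
    exact hp.mem_right
  -- Lattice points outside `K` keep their partners, so all changes take place between `K` and `f ''
  -- K`.
  have hstable : ∀ p ∈ φ, p ∉ K → IsMatchedPair φ χ p (f p) := fun p hp hpK =>
    (hf p hp).of_subset hφ hψ hχψ fun q y hpq hqy =>
      (hχ y).2 ⟨⟨q, hqy⟩, fun hyB => hpK ⟨hp, q, y, hpq, hqy, hyB⟩⟩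
  have hfinj : Set.InjOn f φ := fun p hp q hq hpq =>
    (hf p hp).left_unique (hpq ▸ hf q hq)
  have hrange : ∀ x, (∃ p, IsMatchedPair φ ψ p x) → ∃ p ∈ φ, f p = x := fun x ⟨p, hp⟩ =>
    ⟨p, hp.mem_left, (hf p hp.mem_left).right_unique hp⟩
  set U := {p ∈ φ | ¬ ∃ x, IsMatchedPair φ χ p x}
  set V := {x ∈ χ | ¬ ∃ p, IsMatchedPair φ χ p x}
  set S := {x | (∃ p, IsMatchedPair φ ψ p x) ∧ x ∈ B}
  have hUK : U ⊆ K := fun p hp => by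
    by_contra hpK
    exact hp.2 ⟨_, hstable p hp.1 hpK⟩
  set M := {p ∈ K | ∃ x, IsMatchedPair φ χ p x}
  set N := {x ∈ f '' K | ∃ p, IsMatchedPair φ χ p x}
  -- Matching in `χ` is a bijection from `M` to `N`: partners outside `f '' K` are already taken by
  -- points outside `K`, and conversely.
  have hMN : M.encard = N.encard := by
    have hM : ∀ p ∈ M, ∃ x, IsMatchedPair φ χ p x := fun p hp => hp.2
    choose! g hg using hM
    have hginj : Set.InjOn g M := fun p hp q hq hpq =>
      (hg p hp).left_unique (hpq ▸ hg q hq)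
    rw [← hginj.encard_image]
    congr 1
    ext x
    constructor
    · rintro ⟨p, hp, rfl⟩
      refine ⟨?_, p, hg p hp⟩
      obtain ⟨q, hq, hqx⟩ := hrange _ ((hχ _).1 (hg p hp).mem_right).1
      refine ⟨q, ?_, hqx⟩
      by_contra hqK
      have := (hqx ▸ hstable q hq hqK).left_unique (hg p hp)
      exact hqK (this ▸ hp.1)
    · rintro ⟨⟨q, hqK, rfl⟩, p, hp⟩
      have hpM : p ∈ M := by
        refine ⟨?_, _, hp⟩
        by_contra hpK
        have := hfinj hp.mem_left (hKφ hqK) ((hstable p hp.mem_left hpK).right_unique hp)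
        exact hpK (this ▸ hqK)
      exact ⟨p, hpM, (hg p hpM).right_unique hp⟩
  have hUM : K.encard = U.encard + M.encard := by
    rw [← Set.encard_union_eq]
    · congr 1
      ext p
      constructor
      · intro hp
        by_cases h : ∃ x, IsMatchedPair φ χ p x
        · exact .inr ⟨hp, h⟩
        · exact .inl ⟨hKφ hp, h⟩
      · rintro (hp | hp)
        · exact hUK hp
        · exact hp.1
    · exact Set.disjoint_left.2 fun p hp hp' => hp.2 hp'.2
  -- The old partners of `K` are either deleted, left unmatched in `χ`, or matched in `χ`.
  have hSVN : (f '' K).encard = S.encard + V.encard + N.encard := by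
    rw [← Set.encard_union_eq, ← Set.encard_union_eq]
    · congr 1
      ext x
      constructor
      · rintro ⟨p, hp, rfl⟩
        have hp' := hf p (hKφ hp)
        by_cases hB : f p ∈ B
        · exact .inl (.inl ⟨⟨p, hp'⟩, hB⟩)
        · by_cases h : ∃ q, IsMatchedPair φ χ q (f p)
          · exact .inr ⟨⟨p, hp, rfl⟩, h⟩
          · exact .inl (.inr ⟨(hχ _).2 ⟨⟨p, hp'⟩, hB⟩, h⟩)
      · rintro ((⟨hx, hB⟩ | ⟨hx, h⟩) | hx)
        · obtain ⟨p, hp, rfl⟩ := hrange x hx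
          exact ⟨p, ⟨hp, p, _, .refl, hf p hp, hB⟩, rfl⟩
        · obtain ⟨p, hp, rfl⟩ := hrange x ((hχ x).1 hx).1
          refine ⟨p, ?_, rfl⟩
          by_contra hpK
          exact h ⟨p, hstable p hp hpK⟩
        · exact hx.1
    · rw [Set.disjoint_union_left]
      refine ⟨Set.disjoint_left.2 fun x hx hx' => ?_, Set.disjoint_left.2 fun x hx hx' => ?_⟩
      · obtain ⟨p, hp⟩ := hx'.2
        exact ((hχ x).1 hp.mem_right).2 hx.2
      · exact hx.2 hx'.2
    · exact Set.disjoint_left.2 fun x hx hx' => ((hχ x).1 hx'.1).2 hx.2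
  refine ⟨?_, hfin.subset hUK⟩
  rw [(hfinj.mono hKφ).encard_image, hUM, hMN] at hSVN
  -- Finiteness of `K` is what permits cancelling the matched part from both counts.
  have hN : N.encard ≠ ⊤ := Set.encard_ne_top_iff.2 ((hfin.image f).subset (Set.sep_subset _ _))
  exact (WithTop.add_right_cancel hN hSVN).symm

end Counting

/-! ## The integer lattice -/

section Lattice

variable {d : ℕ}

theorem intPoint_zero : (intPoint 0 : E d) = 0 := by
  ext i
  simp [intPoint]

theorem countable_intLattice : (intLattice d).Countable := Set.countable_range _

theorem finite_setOf_norm_intPoint_le (r : ℝ) : {w : Fin d → ℤ | ‖(intPoint w : E d)‖ ≤ r}.Finite := by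
  refine (Set.Finite.pi' fun _ : Fin d => Set.finite_Icc (-⌈r⌉) ⌈r⌉).subset fun w hw i => ?_
  have h1 : |(w i : ℝ)| ≤ r := by
    have := PiLp.norm_apply_le (intPoint w : E d) i
    exact this.trans hw
  have h2 := abs_le.1 (h1.trans (Int.le_ceil r))
  exact ⟨by exact_mod_cast h2.1, by exact_mod_cast h2.2⟩

theorem finite_intLattice_inter {B : Set (E d)} (hB : Bornology.IsBounded B) :
    (intLattice d ∩ B).Finite := by
  obtain ⟨r, hr⟩ := hB.exists_norm_le
  refine ((finite_setOf_norm_intPoint_le r).image intPoint).subset ?_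
  rintro _ ⟨⟨w, rfl⟩, hw⟩
  exact ⟨w, hr _ hw, rfl⟩

theorem image_add_intLattice (w : Fin d → ℤ) :
    (· + (-intPoint w)) '' intLattice d = intLattice d := by
  have hsub (v w : Fin d → ℤ) : (intPoint v : E d) + (-intPoint w) = intPoint (v - w) := by
    ext i
    simp [intPoint, sub_eq_add_neg]
  ext x
  constructor
  · rintro ⟨_, ⟨v, rfl⟩, rfl⟩
    exact ⟨v - w, (hsub v w).symm⟩
  · rintro ⟨v, rfl⟩
    exact ⟨_, ⟨v + w, rfl⟩, by simp only [hsub, add_sub_cancel_right]⟩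

/-- The remainder modulo two has coordinates in `{0, 1}`, hence norm at most `√d`. Halving supplies
radii that are norms of lattice points, as in the summability assumption. -/
theorem two_mul_norm_intPoint_ediv_two_le (w : Fin d → ℤ) :
    2 * ‖(intPoint (fun i => w i / 2) : E d)‖ ≤ ‖(intPoint w : E d)‖ + √d := by
  have hr : ‖(intPoint (fun i => w i % 2) : E d)‖ ≤ √d := by
    rw [EuclideanSpace.norm_eq]
    refine Real.sqrt_le_sqrt ?_
    calc ∑ i, ‖(intPoint (fun i => w i % 2) : E d) i‖ ^ 2 ≤ ∑ _i : Fin d, (1 : ℝ) := by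
          refine Finset.sum_le_sum fun i _ => ?_
          rcases Int.emod_two_eq_zero_or_one (w i) with h | h <;> simp [intPoint, h]
      _ = d := by simp
  have heq : (2 : ℝ) • (intPoint (fun i => w i / 2) : E d) =
      intPoint w - intPoint (fun i => w i % 2) := by
    ext i
    have : 2 * (w i / 2) = w i - w i % 2 := by omega
    simpa [intPoint] using congrArg (Int.cast : ℤ → ℝ) this
  calc 2 * ‖(intPoint (fun i => w i / 2) : E d)‖
      = ‖(2 : ℝ) • (intPoint (fun i => w i / 2) : E d)‖ := by simp [norm_smul]
    _ ≤ ‖(intPoint w : E d)‖ + ‖(intPoint (fun i => w i % 2) : E d)‖ := heq ▸ norm_sub_le _ _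
    _ ≤ _ := by gcongr

/-- A vector is determined by its half and its parities, so halving is at most `2^d`-to-one. -/
theorem tsum_ediv_two_ne_top {f : (Fin d → ℤ) → ℝ≥0∞} (hf : ∑' w, f w ≠ ∞) :
    ∑' w : Fin d → ℤ, f (fun i => w i / 2) ≠ ∞ := by
  let e : (Fin d → ℤ) → (Fin d → ℤ) × (Fin d → Bool) :=
    fun w => (fun i => w i / 2, fun i => decide (w i % 2 = 0))
  have he : Function.Injective e := fun w w' h => by
    rw [Prod.ext_iff] at h
    funext i
    have h1 : w i / 2 = w' i / 2 := congrFun h.1 i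
    have h2 : decide (w i % 2 = 0) = decide (w' i % 2 = 0) := congrFun h.2 i
    rw [decide_eq_decide] at h2
    omega
  refine ne_top_of_le_ne_top ?_ (ENNReal.tsum_comp_le_tsum_of_injective he fun u => f u.1)
  rw [ENNReal.tsum_prod (f := fun w (_ : Fin d → Bool) => f w)]
  simp only [ENNReal.tsum_const, ENNReal.tsum_mul_left]
  exact ENNReal.mul_ne_top (by simp) hf

end Lattice

/-! ## Rigidity -/

theorem ENat.eq_toNat_sub_toNat {a b c : ℕ∞} (h : a + b = c) (hc : c ≠ ⊤) :
    a = ((c.toNat - b.toNat : ℕ) : ℕ∞) := by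
  subst h
  obtain ⟨ha, hb⟩ := not_or.1 (fun h => hc (WithTop.add_eq_top.2 h))
  lift a to ℕ using ha
  lift b to ℕ using hb
  rw [← Nat.cast_add, ENat.toNat_natCast, ENat.toNat_natCast, Nat.add_sub_cancel]

section Rigidity

variable {Ω : Type*} [MeasurableSpace Ω] {P : Measure Ω} {d : ℕ} {Ψ : Ω → PointConfig d}

/-- Translation by `-intPoint w` preserves the lattice and the law of `Ψ`, and moves `intPoint w` to
the origin. -/
theorem IsStationaryProcess.measure_hasFarDependence (hstat : IsStationaryProcess P Ψ) (r : ℝ)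
    (w : Fin d → ℤ) :
    P {ω | HasFarDependence (intLattice d) (Ψ ω).points r (intPoint w)} =
      P {ω | HasFarDependence (intLattice d) (Ψ ω).points r 0} := by
  have h := (hstat (-intPoint w)).measure_mem_eq
    (measurableSet_hasFarDependence countable_intLattice r 0)
  refine (congrArg P (Set.ext fun ω => ?_)).trans h
  change HasFarDependence _ (Ψ ω).points r _ ↔ HasFarDependence _ ((Ψ ω).translate _).points r 0
  constructor
  · intro h
    have := h.image_add (-intPoint w)
    rwa [image_add_intLattice, add_neg_cancel] at this
  · intro h
    have := h.image_add (intPoint w)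
    rw [← image_add_intLattice w, zero_add] at this
    simpa only [PointConfig.translate, PointConfig.points, Set.image_image, neg_add_cancel_right,
      Set.image_id'] using this

/-- The number of unmatched lattice points minus the number of unmatched points of `χ`. -/
noncomputable def unmatchedDifference (χ : PointConfig d) : ℕ :=
  {p ∈ intLattice d | ¬ ∃ x, IsMatchedPair (intLattice d) χ.points p x}.encard.toNat -
    {x ∈ χ.points | ¬ ∃ p, IsMatchedPair (intLattice d) χ.points p x}.encard.toNat

theorem measurable_unmatchedDifference :
    Measurable (unmatchedDifference : PointConfig d → ℕ) := by
  have hL {T : Type} [MeasurableSpace T] : MeasurablyEnumerable fun _ : T => intLattice d :=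
    .of_countable countable_intLattice
  have hχ := (PointConfig.enumerable_points (d := d)).comp
    (measurable_fst (α := PointConfig d) (β := E d))
  have h1 := (hL.sep
    (p := fun (χ : PointConfig d) p => ¬ ∃ x, IsMatchedPair (intLattice d) χ.points p x)
    (measurableSet_exists_isMatchedPair_left hL hχ measurable_snd).compl
    ).measurable_encard
  have h2 := (PointConfig.enumerable_points.sep
    (p := fun (χ : PointConfig d) x => ¬ ∃ p, IsMatchedPair (intLattice d) χ.points p x)
    (measurableSet_exists_isMatchedPair_right hL hχ measurable_snd).compl).measurable_encard
  have h3 : Measurable ENat.toNat := measurable_of_countable _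
  exact (h3.comp h1).sub (h3.comp h2)

end Rigidity

theorem theorem7p1 {Ω : Type*} [MeasurableSpace Ω] (P : Measure Ω) [IsProbabilityMeasure P]
    (d : ℕ) (hd : 1 ≤ d) (Ψ : Ω → PointConfig d) (hΨ : Measurable Ψ)
    (hstat : IsStationaryProcess P Ψ) (hint : 1 ≤ intensity P Ψ)
    (hflower : ∑' w : Fin d → ℤ,
      P {ω | ¬ matchingFlower (intLattice d) (Ψ ω).points 0 ⊆ Metric.closedBall 0 ‖(intPoint w : E d)‖}
        < ∞) :
    Measurable (fun ω => matchedPoints (intLattice d) (Ψ ω)) ∧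
      IsNumberRigid P (fun ω => matchedPoints (intLattice d) (Ψ ω)) := by
  have hzero : (0 : E d) ∈ intLattice d := ⟨0, intPoint_zero⟩
  have hle (r : ℝ) (w : Fin d → ℤ) :
      P {ω | HasFarDependence (intLattice d) (Ψ ω).points r (intPoint w)} ≤
        P {ω | ¬ matchingFlower (intLattice d) (Ψ ω).points 0 ⊆ Metric.closedBall 0 r} := by
    rw [hstat.measure_hasFarDependence]
    exact measure_mono fun ω hω => hω.not_matchingFlower_subset hd hzero
  have hmatched : ∀ᵐ ω ∂P, ∀ w : Fin d → ℤ,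
      ∃ x, IsMatchedPair (intLattice d) (Ψ ω).points (intPoint w) x := by
    rw [ae_all_iff]
    intro w
    rw [ae_iff]
    by_contra hpos
    have : Nonempty (Fin d) := ⟨⟨0, hd⟩⟩
    have : Infinite (Fin d → ℤ) := inferInstance
    -- Being unmatched counts as far dependence at every radius, so one positive probability would
    -- bound all terms of the convergent series over an infinite lattice from below.
    refine (ENNReal.tsum_const_eq_top_of_ne_zero (α := Fin d → ℤ) hpos).not_lt ?_
    refine (ENNReal.tsum_le_tsum fun v => ?_).trans_lt hflower
    exact (measure_mono fun ω hω => Or.inl hω).trans (hle _ w)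
  refine ⟨(measurable_matchedPoints countable_intLattice).comp hΨ, fun B _ hB => ?_⟩
  refine ⟨unmatchedDifference, measurable_unmatchedDifference, ?_⟩
  obtain ⟨R, hR⟩ := hB.exists_norm_le
  have hfin : ∀ᵐ ω ∂P, {w : Fin d → ℤ | ∃ q y,
      Relation.ReflTransGen (DependsStep (intLattice d) (Ψ ω).points) (intPoint w) q ∧
        IsMatchedPair (intLattice d) (Ψ ω).points q y ∧ y ∈ B}.Finite := by
    have hsum : ∑' w : Fin d → ℤ, P {ω | HasFarDependence (intLattice d) (Ψ ω).points
        ‖(intPoint (fun i => w i / 2) : E d)‖ (intPoint w)} ≠ ∞ :=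
      ne_top_of_le_ne_top (tsum_ediv_two_ne_top hflower.ne)
        (ENNReal.tsum_le_tsum fun w => hle _ w)
    -- Borel–Cantelli: almost surely only finitely many `w` depend on points farther away than the
    -- norm of their halved vector.
    filter_upwards [ae_finite_setOfPred_mem hsum] with ω hω
    refine (hω.union (finite_setOf_norm_intPoint_le (2 * R + √d))).subset ?_
    rintro w ⟨q, y, hwq, hqy, hyB⟩
    by_cases hw : ‖(intPoint w : E d)‖ ≤ 2 * R + √d
    · exact .inr hw
    -- With `‖y‖ ≤ R`, the distance from `y` to `w` is at least `‖w‖ - R`. This exceeds `(‖w‖ + √d)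
    -- / 2`, a bound for the norm of the halved vector, exactly when `‖w‖ > 2R + √d`.
    · refine .inl (.inr ⟨q, hqy.mem_left, hwq, y, hqy.mem_right, hqy, ?_⟩)
      have h1 := two_mul_norm_intPoint_ediv_two_le w
      have h2 := hR y hyB
      have h3 := norm_sub_norm_le (intPoint w) y
      rw [norm_sub_rev] at h3
      linarith
  filter_upwards [hmatched, hfin] with ω hω hωfin
  set ψ := Ψ ω
  have hmem (x : E d) : x ∈ ((matchedPoints (intLattice d) ψ).restrict Bᶜ).points ↔
      (∃ p, IsMatchedPair (intLattice d) ψ.points p x) ∧ x ∉ B :=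
    and_congr_left fun _ => mem_matchedPoints_iff
  obtain ⟨hcard, hUfin⟩ := encard_matched_inter_add (fun _ => finite_intLattice_inter) ψ.2 hmem
    (by rintro _ ⟨w, rfl⟩; exact hω w)
    ((hωfin.image intPoint).subset (by rintro _ ⟨⟨w, rfl⟩, hw⟩; exact ⟨w, hw, rfl⟩))
  have hcount : (matchedPoints (intLattice d) ψ).count B =
      {x | (∃ p, IsMatchedPair (intLattice d) ψ.points p x) ∧ x ∈ B}.encard :=
    congrArg Set.encard (Set.ext fun x => and_congr_left fun _ => mem_matchedPoints_iff)
  rw [hcount]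
  exact ENat.eq_toNat_sub_toNat hcard (Set.encard_ne_top_iff.2 hUfin)
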